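/- A compact quantum group is a pair $(B,\delta)$, where $B$ is a unital $\mathrm{C}^*$-algebra and $\delta\colon B\to B\otimes B$ is a unital $*$-homomorphism into the minimal (spatial) $\mathrm{C}^*$-tensor product such that $(\delta\otimes\mathrm{id})\circ\delta=(\mathrm{id}\otimes\delta)\circ\delta$ and the sets $\{(a\otimes I)\delta(b):a,b\in B\}$ and $\{\delta(a)(I\otimes b):a,b\in B\}$ are linearly dense in $B\otimes B$ (the zero algebra is allowed). A morphism of compact quantum groups $(B,\delta_B)\to(C,\delta_C)$ is a unital $*$-homomorphism $f\colon B\to C$ with $\delta_C\circ f=(f\otimes f)\circ\delta_B$; it is an isomorphism if it has an inverse which is again such a morphism. For a compact quantum group $(B,\delta)$ let $J=\{b\in B:\tau(b^*b)=0\text{ for every tracial state }\tau\text{ on }B\}$ (so $J=B$ if there are no tracial states); it is a closed two-sided ideal. Put $B_{\mathrm{Kac}}=B/J$, let $\pi\colon B\to B_{\mathrm{Kac}}$ be the quotient map, and let $\delta_{\mathrm{Kac}}$ be the comultiplication determined by $\delta_{\mathrm{Kac}}(\pi(b))=(\pi\otimes\pi)(\delta(b))$. The compact quantum group $(B_{\mathrm{Kac}},\delta_{\mathrm{Kac}})$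 is the canonical Kac quotient of $(B,\delta)$. **Lemma.** For $k=1,2$ let $(B^k,\delta^k)$ be a compact quantum group with canonical Kac quotient $(B^k_{\mathrm{Kac}},\delta^k_{\mathrm{Kac}})$ and quotient map $\pi_k\colon B^k\to B^k_{\mathrm{Kac}}$. Let $(B^2,\delta^2)$ be a quantum subgroup of $(B^1,\delta^1)$ via $\Theta$, that is, $\Theta\colon B^1\to B^2$ is a surjective unital $*$-homomorphism with $\delta^2\circ\Theta=(\Theta\otimes\Theta)\circ\delta^1$, and assume $\ker\Theta\subset\ker\pi_1$. Then the induced morphism $\widetilde\Theta\colon B^1_{\mathrm{Kac}}\to B^2_{\mathrm{Kac}}$, i.e. the unique unital $*$-homomorphism with $\widetilde\Theta\circ\pi_1=\pi_2\circ\Theta$, is an isomorphism of compact quantum groups from $(B^1_{\mathrm{Kac}},\delta^1_{\mathrm{Kac}})$ to $(B^2_{\mathrm{Kac}},\delta^2_{\mathrm{Kac}})$. -/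

import Mathlib

open scoped TensorProduct

universe u

noncomputable section

section HilbertSpaceTensorProduct

/-- The Hilbert space tensor product: the completion of the algebraic tensor product. -/
def HilbertTensor (H K : Type u) [NormedAddCommGroup H] [InnerProductSpace ℂ H]
    [NormedAddCommGroup K] [InnerProductSpace ℂ K] : Type u :=
  UniformSpace.Completion (H ⊗[ℂ] K)

namespace HilbertTensor

variable (H K : Type u) [NormedAddCommGroup H] [InnerProductSpace ℂ H]
  [NormedAddCommGroup K] [InnerProductSpace ℂ K]

instance : NormedAddCommGroup (HilbertTensor H K) :=
  inferInstanceAs (NormedAddCommGroup (UniformSpace.Completion (H ⊗[ℂ] K)))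

instance : InnerProductSpace ℂ (HilbertTensor H K) :=
  inferInstanceAs (InnerProductSpace ℂ (UniformSpace.Completion (H ⊗[ℂ] K)))

instance : CompleteSpace (HilbertTensor H K) :=
  inferInstanceAs (CompleteSpace (UniformSpace.Completion (H ⊗[ℂ] K)))

/-- The inclusion of the algebraic tensor product. -/
def incl : (H ⊗[ℂ] K) →ₗᵢ[ℂ] HilbertTensor H K := UniformSpace.Completion.toComplₗᵢ

theorem denseRange_incl : DenseRange (incl H K) := UniformSpace.Completion.denseRange_coe

variable {H K}

/-- The elementary tensor `v ⊗ w` in the Hilbert space tensor product. -/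
def vec (v : H) (w : K) : HilbertTensor H K := incl H K (v ⊗ₜ[ℂ] w)

/-- The bounded operator `T ⊗ T'` on the Hilbert space tensor product. -/
def op (T : H →L[ℂ] H) (T' : K →L[ℂ] K) : HilbertTensor H K →L[ℂ] HilbertTensor H K :=
  ContinuousLinearMap.extend ((incl H K).toContinuousLinearMap ∘L TensorProduct.mapL T T')
    (incl H K).toContinuousLinearMap

theorem op_incl (T : H →L[ℂ] H) (T' : K →L[ℂ] K) (x : H ⊗[ℂ] K) :
    op T T' (incl H K x) = incl H K (TensorProduct.mapL T T' x) :=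
  ContinuousLinearMap.extend_eq (e := (incl H K).toContinuousLinearMap) _ (denseRange_incl H K)
    (incl H K).isometry.isUniformInducing x

@[simp] theorem op_vec (T : H →L[ℂ] H) (T' : K →L[ℂ] K) (v : H) (w : K) :
    op T T' (vec v w) = vec (T v) (T' w) := by
  rw [vec, op_incl]; rfl

theorem vec_add_left (v v' : H) (w : K) : vec (v + v') w = vec v w + vec v' w := by
  simp [vec, TensorProduct.add_tmul]

theorem vec_add_right (v : H) (w w' : K) : vec v (w + w') = vec v w + vec v w' := by
  simp [vec, TensorProduct.tmul_add]

theorem vec_smul_left (c : ℂ) (v : H) (w : K) : vec (c • v) w = c • vec v w := by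
  rw [vec, vec, ← TensorProduct.smul_tmul', map_smul]

theorem vec_smul_right (c : ℂ) (v : H) (w : K) : vec v (c • w) = c • vec v w := by
  rw [vec, vec, TensorProduct.tmul_smul, map_smul]

@[simp] theorem inner_vec (v v' : H) (w w' : K) :
    inner ℂ (vec v w) (vec v' w') = inner ℂ v v' * inner ℂ w w' := by
  simp [vec]

@[simp] theorem norm_vec (v : H) (w : K) : ‖vec v w‖ = ‖v‖ * ‖w‖ := by
  simp [vec]

/-- Closed additive conditions on the tensor product can be checked on elementary tensors. -/
theorem vec_induction {P : HilbertTensor H K → Prop} (hc : IsClosed {x | P x})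
    (h0 : P 0) (hadd : ∀ x y, P x → P y → P (x + y)) (hv : ∀ v w, P (vec v w))
    (x : HilbertTensor H K) : P x := by
  refine (denseRange_incl H K).induction_on x hc fun x => ?_
  induction x with
  | zero => rw [map_zero]; exact h0
  | tmul v w => exact hv v w
  | add x y hx hy => rw [map_add]; exact hadd _ _ hx hy

theorem ext_op {D : Type*} [NormedAddCommGroup D] [NormedSpace ℂ D]
    {f g : HilbertTensor H K →L[ℂ] D} (h : ∀ v w, f (vec v w) = g (vec v w)) : f = g := by
  ext x
  refine vec_induction (P := fun x => f x = g x) (isClosed_eq f.continuous g.continuous)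
    (by simp) (fun x y hx hy => by simp [hx, hy]) h x

theorem ext_inner_op {f g : HilbertTensor H K →L[ℂ] HilbertTensor H K}
    (h : ∀ v w v' w', inner ℂ (vec v' w') (f (vec v w)) = inner ℂ (vec v' w') (g (vec v w))) :
    f = g := by
  apply ext_op
  intro v w
  refine ext_inner_left ℂ fun x => ?_
  refine vec_induction (P := fun x => inner ℂ x (f (vec v w)) = inner ℂ x (g (vec v w)))
    (isClosed_eq (by fun_prop) (by fun_prop)) (by simp)
    (fun x y hx hy => by rw [inner_add_left, inner_add_left, hx, hy]) (h v w) x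

theorem op_add_left (T₁ T₂ : H →L[ℂ] H) (T' : K →L[ℂ] K) :
    op (T₁ + T₂) T' = op T₁ T' + op T₂ T' := by
  apply ext_op; intro v w; simp [vec_add_left]

theorem op_add_right (T : H →L[ℂ] H) (T₁ T₂ : K →L[ℂ] K) :
    op T (T₁ + T₂) = op T T₁ + op T T₂ := by
  apply ext_op; intro v w; simp [vec_add_right]

theorem op_smul_left (c : ℂ) (T : H →L[ℂ] H) (T' : K →L[ℂ] K) :
    op (c • T) T' = c • op T T' := by
  apply ext_op; intro v w; simp [vec_smul_left]

theorem op_smul_right (c : ℂ) (T : H →L[ℂ] H) (T' : K →L[ℂ] K) :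
    op T (c • T') = c • op T T' := by
  apply ext_op; intro v w; simp [vec_smul_right]

theorem op_mul (T₁ T₂ : H →L[ℂ] H) (T₁' T₂' : K →L[ℂ] K) :
    op T₁ T₁' * op T₂ T₂' = op (T₁ * T₂) (T₁' * T₂') := by
  apply ext_op; intro v w; simp

theorem op_one : op (1 : H →L[ℂ] H) (1 : K →L[ℂ] K) = 1 := by
  apply ext_op; intro v w; simp

theorem op_star [CompleteSpace H] [CompleteSpace K] (T : H →L[ℂ] H) (T' : K →L[ℂ] K) :
    star (op T T') = op (star T) (star T') := by
  apply ext_inner_op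
  intro v w v' w'
  rw [ContinuousLinearMap.star_eq_adjoint, ContinuousLinearMap.adjoint_inner_right]
  simp [ContinuousLinearMap.star_eq_adjoint, ContinuousLinearMap.adjoint_inner_right]

theorem norm_op_le (T : H →L[ℂ] H) (T' : K →L[ℂ] K) : ‖op T T'‖ ≤ ‖T‖ * ‖T'‖ := by
  refine ContinuousLinearMap.opNorm_le_bound _ (by positivity) fun x => ?_
  refine (denseRange_incl H K).induction_on x (isClosed_le (by fun_prop) (by fun_prop))
    fun x => ?_
  rw [op_incl, LinearIsometry.norm_map, LinearIsometry.norm_map]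
  exact (ContinuousLinearMap.le_opNorm _ _).trans
    (mul_le_mul_of_nonneg_right (TensorProduct.norm_mapL_le _ _) (norm_nonneg _))

end HilbertTensor

end HilbertSpaceTensorProduct

section AlgebraicTensorProduct

variable (A B : Type u) [CStarAlgebra A] [CStarAlgebra B]

/-- The algebraic tensor product of two C*-algebras, to be equipped with the minimal norm. -/
def AlgTensor : Type u := A ⊗[ℂ] B

namespace AlgTensor

instance : Ring (AlgTensor A B) := inferInstanceAs (Ring (A ⊗[ℂ] B))
instance : Algebra ℂ (AlgTensor A B) := inferInstanceAs (Algebra ℂ (A ⊗[ℂ] B))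
instance : StarRing (AlgTensor A B) := inferInstanceAs (StarRing (A ⊗[ℂ] B))
instance : StarModule ℂ (AlgTensor A B) := inferInstanceAs (StarModule ℂ (A ⊗[ℂ] B))

variable {A B}

/-- The elementary tensor `a ⊗ b`. -/
def tmul (a : A) (b : B) : AlgTensor A B := a ⊗ₜ[ℂ] b

theorem induction {P : AlgTensor A B → Prop} (h0 : P 0)
    (ht : ∀ a b, P (tmul a b)) (hadd : ∀ x y, P x → P y → P (x + y))
    (x : AlgTensor A B) : P x :=
  TensorProduct.induction_on (motive := P) x h0 ht hadd

theorem tmul_mul_tmul (a a' : A) (b b' : B) :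
    tmul a b * tmul a' b' = tmul (a * a') (b * b') := Algebra.TensorProduct.tmul_mul_tmul ..

theorem star_tmul (a : A) (b : B) : star (tmul a b) = tmul (star a) (star b) :=
  TensorProduct.star_tmul a b

theorem one_def : (1 : AlgTensor A B) = tmul 1 1 := rfl

theorem add_tmul (a a' : A) (b : B) : tmul (a + a') b = tmul a b + tmul a' b :=
  TensorProduct.add_tmul a a' b

theorem tmul_add (a : A) (b b' : B) : tmul a (b + b') = tmul a b + tmul a b' :=
  TensorProduct.tmul_add a b b'

theorem smul_tmul (c : ℂ) (a : A) (b : B) : tmul (c • a) b = c • tmul a b := rfl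

theorem tmul_smul (c : ℂ) (a : A) (b : B) : tmul a (c • b) = c • tmul a b :=
  TensorProduct.tmul_smul c a b

section Rep

variable {H K : Type u} [NormedAddCommGroup H] [InnerProductSpace ℂ H] [CompleteSpace H]
  [NormedAddCommGroup K] [InnerProductSpace ℂ K] [CompleteSpace K]
  (ρ : A →⋆ₐ[ℂ] (H →L[ℂ] H)) (σ : B →⋆ₐ[ℂ] (K →L[ℂ] K))

/-- The representation `a ⊗ b ↦ ρ(a) ⊗ σ(b)`, without the involution. -/
def repAux : AlgTensor A B →ₐ[ℂ] (HilbertTensor H K →L[ℂ] HilbertTensor H K) :=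
  Algebra.TensorProduct.algHomOfLinearMapTensorProduct
    (TensorProduct.lift (LinearMap.mk₂ ℂ (fun a b => HilbertTensor.op (ρ a) (σ b))
      (by simp [HilbertTensor.op_add_left]) (by simp [HilbertTensor.op_smul_left])
      (by simp [HilbertTensor.op_add_right]) (by simp [HilbertTensor.op_smul_right])))
    (by intro a₁ a₂ b₁ b₂; simp [HilbertTensor.op_mul])
    (by simp [HilbertTensor.op_one])

theorem repAux_tmul (a : A) (b : B) : repAux ρ σ (tmul a b) = HilbertTensor.op (ρ a) (σ b) :=
  rfl

/-- The representation `a ⊗ b ↦ ρ(a) ⊗ σ(b)` of the algebraic tensor product on the Hilbert space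
tensor product. -/
def rep : AlgTensor A B →⋆ₐ[ℂ] (HilbertTensor H K →L[ℂ] HilbertTensor H K) where
  toAlgHom := repAux ρ σ
  map_star' := by
    intro x
    change repAux ρ σ (star x) = star (repAux ρ σ x)
    induction x using AlgTensor.induction with
    | h0 => rw [star_zero, map_zero, star_zero]
    | ht a b =>
      rw [star_tmul, repAux_tmul, repAux_tmul, HilbertTensor.op_star, map_star ρ a, map_star σ b]
    | hadd x y hx hy => rw [star_add, map_add, map_add, hx, hy, star_add]

theorem rep_tmul (a : A) (b : B) : rep ρ σ (tmul a b) = HilbertTensor.op (ρ a) (σ b) :=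
  repAux_tmul ρ σ a b

end Rep

end AlgTensor

end AlgebraicTensorProduct

theorem StarAlgHom.norm_le' {D E : Type*} [CStarAlgebra D] [CStarAlgebra E] (f : D →⋆ₐ[ℂ] E)
    (x : D) : ‖f x‖ ≤ ‖x‖ := NonUnitalStarAlgHom.norm_apply_le f x

theorem StarAlgHom.continuous' {D E : Type*} [CStarAlgebra D] [CStarAlgebra E]
    (f : D →⋆ₐ[ℂ] E) : Continuous f :=
  AddMonoidHomClass.continuous_of_bound f 1 fun x => by simpa using f.norm_le' x

/-- A unital `*`-representation of a unital C*-algebra on a Hilbert space. -/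
structure HilbertRep (A : Type u) [CStarAlgebra A] where
  /-- The underlying Hilbert space. -/
  H : Type u
  [normed : NormedAddCommGroup H]
  [ips : InnerProductSpace ℂ H]
  [complete : CompleteSpace H]
  /-- The representation. -/
  hom : A →⋆ₐ[ℂ] (H →L[ℂ] H)

attribute [instance] HilbertRep.normed HilbertRep.ips HilbertRep.complete

section MinimalTensorProduct

variable {A B : Type u} [CStarAlgebra A] [CStarAlgebra B]

namespace AlgTensor

/-- The minimal (spatial) norm: the supremum of `‖(ρ ⊗ σ)(x)‖` over all representations `ρ` of `A`
and `σ` of `B` on Hilbert spaces. -/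
def minNorm (x : AlgTensor A B) : ℝ :=
  ⨆ p : HilbertRep A × HilbertRep B, ‖rep p.1.hom p.2.hom x‖

theorem bddAbove (x : AlgTensor A B) :
    BddAbove (Set.range fun p : HilbertRep A × HilbertRep B => ‖rep p.1.hom p.2.hom x‖) := by
  suffices h : ∃ C, ∀ p : HilbertRep A × HilbertRep B, ‖rep p.1.hom p.2.hom x‖ ≤ C by
    obtain ⟨C, hC⟩ := h
    exact ⟨C, by rintro _ ⟨p, rfl⟩; exact hC p⟩
  induction x using AlgTensor.induction with
  | h0 => exact ⟨0, fun p => by simp⟩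
  | ht a b =>
    refine ⟨‖a‖ * ‖b‖, fun p => ?_⟩
    rw [rep_tmul]
    exact (HilbertTensor.norm_op_le _ _).trans
      (mul_le_mul (StarAlgHom.norm_le' _ _) (StarAlgHom.norm_le' _ _) (norm_nonneg _)
        (norm_nonneg _))
  | hadd x y hx hy =>
    obtain ⟨C, hC⟩ := hx
    obtain ⟨D, hD⟩ := hy
    refine ⟨C + D, fun p => ?_⟩
    rw [map_add]
    exact (norm_add_le _ _).trans (add_le_add (hC p) (hD p))

theorem le_minNorm (R : HilbertRep A) (S : HilbertRep B) (x : AlgTensor A B) :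
    ‖rep R.hom S.hom x‖ ≤ minNorm x := le_ciSup (bddAbove x) (R, S)

theorem minNorm_nonneg (x : AlgTensor A B) : 0 ≤ minNorm x :=
  Real.iSup_nonneg fun _ => norm_nonneg _

theorem minNorm_le {x : AlgTensor A B} {C : ℝ} (hC : 0 ≤ C)
    (h : ∀ (R : HilbertRep A) (S : HilbertRep B), ‖rep R.hom S.hom x‖ ≤ C) : minNorm x ≤ C :=
  Real.iSup_le (fun p => h p.1 p.2) hC

variable (A B) in
/-- The minimal norm as a ring seminorm. -/
def minSeminorm : RingSeminorm (AlgTensor A B) where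
  toFun := minNorm
  map_zero' := le_antisymm (minNorm_le le_rfl fun R S => by simp) (minNorm_nonneg _)
  add_le' x y := minNorm_le (add_nonneg (minNorm_nonneg _) (minNorm_nonneg _)) fun R S => by
    rw [map_add]
    exact (norm_add_le _ _).trans (add_le_add (le_minNorm R S x) (le_minNorm R S y))
  neg' x := by simp [minNorm]
  mul_le' x y := minNorm_le (mul_nonneg (minNorm_nonneg _) (minNorm_nonneg _)) fun R S => by
    rw [map_mul]
    exact (norm_mul_le _ _).trans (mul_le_mul (le_minNorm R S x) (le_minNorm R S y)
      (norm_nonneg _) (minNorm_nonneg _))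

instance : SeminormedRing (AlgTensor A B) := (minSeminorm A B).toSeminormedRing

theorem norm_def (x : AlgTensor A B) : ‖x‖ = minNorm x := rfl

theorem norm_alg_le (R : HilbertRep A) (S : HilbertRep B) (x : AlgTensor A B) :
    ‖rep R.hom S.hom x‖ ≤ ‖x‖ := le_minNorm R S x

theorem norm_rep_le {H K : Type u} [NormedAddCommGroup H] [InnerProductSpace ℂ H]
    [CompleteSpace H] [NormedAddCommGroup K] [InnerProductSpace ℂ K] [CompleteSpace K]
    (ρ : A →⋆ₐ[ℂ] (H →L[ℂ] H)) (σ : B →⋆ₐ[ℂ] (K →L[ℂ] K)) (x : AlgTensor A B) :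
    ‖rep ρ σ x‖ ≤ ‖x‖ := le_minNorm ⟨H, ρ⟩ ⟨K, σ⟩ x

theorem norm_le {x : AlgTensor A B} {C : ℝ} (hC : 0 ≤ C)
    (h : ∀ (R : HilbertRep A) (S : HilbertRep B), ‖rep R.hom S.hom x‖ ≤ C) : ‖x‖ ≤ C :=
  minNorm_le hC h

instance : NormedAlgebra ℂ (AlgTensor A B) where
  norm_smul_le c x := norm_le (by positivity) fun R S => by
    rw [map_smul, norm_smul]
    exact mul_le_mul_of_nonneg_left (norm_alg_le R S x) (norm_nonneg _)

instance : NormedStarGroup (AlgTensor A B) where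
  norm_star_le x := norm_le (norm_nonneg _) fun R S => by
    rw [map_star, norm_star]
    exact norm_alg_le R S x

theorem norm_mul_self_le (x : AlgTensor A B) : ‖x‖ * ‖x‖ ≤ ‖star x * x‖ := by
  have : ‖x‖ ≤ √‖star x * x‖ := norm_le (by positivity) fun R S => by
    apply Real.le_sqrt_of_sq_le
    rw [sq, ← CStarRing.norm_star_mul_self, ← map_star, ← map_mul]
    exact norm_alg_le R S _
  calc _ ≤ √‖star x * x‖ * √‖star x * x‖ := mul_self_le_mul_self (norm_nonneg _) this
    _ = _ := Real.mul_self_sqrt (norm_nonneg _)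

theorem norm_tmul_le (a : A) (b : B) : ‖tmul a b‖ ≤ ‖a‖ * ‖b‖ := norm_le (by positivity)
  fun R S => by
    rw [rep_tmul]
    exact (HilbertTensor.norm_op_le _ _).trans
      (mul_le_mul (StarAlgHom.norm_le' _ _) (StarAlgHom.norm_le' _ _) (norm_nonneg _)
        (norm_nonneg _))

end AlgTensor

variable (A B)

/-- The minimal (spatial) tensor product of two unital C*-algebras: the completion of the algebraic
tensor product in the minimal norm. -/
def MinTensor : Type u := UniformSpace.Completion (AlgTensor A B)

namespace MinTensor

open UniformSpace

instance : NormedRing (MinTensor A B) :=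
  inferInstanceAs (NormedRing (Completion (AlgTensor A B)))

instance : CompleteSpace (MinTensor A B) :=
  inferInstanceAs (CompleteSpace (Completion (AlgTensor A B)))

instance : Algebra ℂ (MinTensor A B) :=
  inferInstanceAs (Algebra ℂ (Completion (AlgTensor A B)))

/-- The canonical map from the algebraic to the minimal tensor product. -/
def of : AlgTensor A B →ₐ[ℂ] MinTensor A B where
  toRingHom := (Completion.coeRingHom : AlgTensor A B →+* Completion (AlgTensor A B))
  commutes' _ := rfl

theorem denseRange_of : DenseRange (of A B) := Completion.denseRange_coe

theorem isometry_of : Isometry (of A B) := Completion.coe_isometry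

instance : Star (MinTensor A B) where
  star := Completion.map (star : AlgTensor A B → AlgTensor A B)

variable {A B}

@[simp] theorem norm_of (x : AlgTensor A B) : ‖of A B x‖ = ‖x‖ := Completion.norm_coe x

theorem star_of (x : AlgTensor A B) : star (of A B x) = of A B (star x) :=
  Completion.map_coe star_isometry.uniformContinuous x

theorem continuous_star' : Continuous (star : MinTensor A B → MinTensor A B) :=
  Completion.continuous_map

theorem induction {P : MinTensor A B → Prop} (hc : IsClosed {x | P x})
    (h : ∀ x, P (of A B x)) (x : MinTensor A B) : P x :=
  (denseRange_of A B).induction_on x hc h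

theorem induction₂ {P : MinTensor A B → MinTensor A B → Prop}
    (hc : IsClosed {x : MinTensor A B × MinTensor A B | P x.1 x.2})
    (h : ∀ x y, P (of A B x) (of A B y)) (x y : MinTensor A B) : P x y :=
  (denseRange_of A B).induction_on₂ hc h x y

instance : StarRing (MinTensor A B) where
  star_involutive x := by
    refine induction (P := fun x => star (star x) = x)
      (isClosed_eq (continuous_star'.comp continuous_star') continuous_id) (fun x => ?_) x
    rw [star_of, star_of, star_star]
  star_mul x y := by
    refine induction₂ (P := fun x y => star (x * y) = star y * star x)
      (isClosed_eq (continuous_star'.comp (continuous_fst.mul continuous_snd))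
        ((continuous_star'.comp continuous_snd).mul (continuous_star'.comp continuous_fst)))
      (fun x y => ?_) x y
    rw [star_of, star_of, ← map_mul, ← map_mul, star_of, star_mul]
  star_add x y := by
    refine induction₂ (P := fun x y => star (x + y) = star x + star y)
      (isClosed_eq (continuous_star'.comp (continuous_fst.add continuous_snd))
        ((continuous_star'.comp continuous_fst).add (continuous_star'.comp continuous_snd)))
      (fun x y => ?_) x y
    rw [star_of, star_of, ← map_add, ← map_add, star_of, star_add]

instance : NormedAlgebra ℂ (MinTensor A B) where
  norm_smul_le c x := by
    rw [Algebra.smul_def]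
    refine (norm_mul_le _ _).trans (mul_le_mul_of_nonneg_right ?_ (norm_nonneg _))
    rw [← (of A B).commutes, norm_of]
    refine AlgTensor.norm_le (norm_nonneg _) fun R S => ?_
    rw [AlgHomClass.commutes, Algebra.algebraMap_eq_smul_one, norm_smul]
    refine mul_le_of_le_one_right (norm_nonneg _) ?_
    exact ContinuousLinearMap.norm_id_le

instance : CStarRing (MinTensor A B) where
  norm_mul_self_le x := by
    refine induction (P := fun x => ‖x‖ * ‖x‖ ≤ ‖star x * x‖)
      (isClosed_le (by fun_prop) ((continuous_star'.mul continuous_id).norm)) (fun x => ?_) x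
    rw [star_of, ← map_mul, norm_of, norm_of]
    exact AlgTensor.norm_mul_self_le x

instance : StarModule ℂ (MinTensor A B) where
  star_smul c x := by
    refine induction (P := fun x => star (c • x) = star c • star x)
      (isClosed_eq (continuous_star'.comp (continuous_const_smul c))
        (continuous_star'.const_smul (star c))) (fun x => ?_) x
    rw [star_of, ← map_smul, ← map_smul, star_of, star_smul]

instance : CStarAlgebra (MinTensor A B) where

/-- The elementary tensor `a ⊗ b` in the minimal tensor product. -/
def tmul (a : A) (b : B) : MinTensor A B := of A B (AlgTensor.tmul a b)

end MinTensor

end MinimalTensorProduct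

section Functoriality

variable {A B C : Type u} [CStarAlgebra A] [CStarAlgebra B] [CStarAlgebra C]

namespace AlgTensor

/-- The algebra homomorphism on the algebraic tensor product defined by two commuting
`*`-homomorphisms. -/
def prodAlgHom {D : Type*} [CStarAlgebra D] (f : A →⋆ₐ[ℂ] D) (g : B →⋆ₐ[ℂ] D)
    (hfg : ∀ a b, Commute (f a) (g b)) : AlgTensor A B →ₐ[ℂ] D :=
  Algebra.TensorProduct.lift f.toAlgHom g.toAlgHom hfg

theorem prodAlgHom_tmul {D : Type*} [CStarAlgebra D] (f : A →⋆ₐ[ℂ] D) (g : B →⋆ₐ[ℂ] D)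
    (hfg : ∀ a b, Commute (f a) (g b)) (a : A) (b : B) :
    prodAlgHom f g hfg (tmul a b) = f a * g b :=
  Algebra.TensorProduct.lift_tmul f.toAlgHom g.toAlgHom hfg a b

/-- The `*`-homomorphism on the algebraic tensor product defined by two commuting
`*`-homomorphisms. -/
def prodHom {D : Type*} [CStarAlgebra D] (f : A →⋆ₐ[ℂ] D) (g : B →⋆ₐ[ℂ] D)
    (hfg : ∀ a b, Commute (f a) (g b)) : AlgTensor A B →⋆ₐ[ℂ] D where
  toAlgHom := prodAlgHom f g hfg
  map_star' x := by
    change prodAlgHom f g hfg (star x) = star (prodAlgHom f g hfg x)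
    induction x using AlgTensor.induction with
    | h0 => rw [star_zero, map_zero, star_zero]
    | ht a b =>
      rw [star_tmul, prodAlgHom_tmul, prodAlgHom_tmul, map_star, map_star, star_mul,
        ((hfg a b).star_star).eq]
    | hadd x y hx hy => rw [star_add, map_add, map_add, hx, hy, star_add]

@[simp] theorem prodHom_tmul {D : Type*} [CStarAlgebra D] (f : A →⋆ₐ[ℂ] D) (g : B →⋆ₐ[ℂ] D)
    (hfg : ∀ a b, Commute (f a) (g b)) (a : A) (b : B) :
    prodHom f g hfg (tmul a b) = f a * g b :=
  prodAlgHom_tmul f g hfg a b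

theorem hom_ext {D : Type*} [CStarAlgebra D] {f g : AlgTensor A B →⋆ₐ[ℂ] D}
    (h : ∀ a b, f (tmul a b) = g (tmul a b)) : f = g := by
  ext x
  induction x using AlgTensor.induction with
  | h0 => simp
  | ht a b => exact h a b
  | hadd x y hx hy => rw [map_add, map_add, hx, hy]

end AlgTensor

namespace MinTensor

open UniformSpace

theorem continuous_of_contractive {D : Type u} [CStarAlgebra D] (f : AlgTensor A B →⋆ₐ[ℂ] D)
    (hf : ∀ x, ‖f x‖ ≤ ‖x‖) : Continuous (f.toAlgHom.toRingHom : AlgTensor A B →+* D) :=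
  AddMonoidHomClass.continuous_of_bound f 1 fun x => by simpa using hf x

/-- Extension of a contractive `*`-homomorphism to the minimal tensor product, as a ring
homomorphism. -/
def liftAux {D : Type u} [CStarAlgebra D] (f : AlgTensor A B →⋆ₐ[ℂ] D)
    (hf : ∀ x, ‖f x‖ ≤ ‖x‖) : MinTensor A B →+* D :=
  Completion.extensionHom f.toAlgHom.toRingHom (continuous_of_contractive f hf)

theorem liftAux_of {D : Type u} [CStarAlgebra D] (f : AlgTensor A B →⋆ₐ[ℂ] D)
    (hf : ∀ x, ‖f x‖ ≤ ‖x‖) (x : AlgTensor A B) : liftAux f hf (of A B x) = f x :=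
  Completion.extensionHom_coe f.toAlgHom.toRingHom (continuous_of_contractive f hf) x

theorem continuous_liftAux {D : Type u} [CStarAlgebra D] (f : AlgTensor A B →⋆ₐ[ℂ] D)
    (hf : ∀ x, ‖f x‖ ≤ ‖x‖) : Continuous (liftAux f hf) := Completion.continuous_extension

/-- Extension of a contractive `*`-homomorphism to the minimal tensor product. -/
def lift {D : Type u} [CStarAlgebra D] (f : AlgTensor A B →⋆ₐ[ℂ] D)
    (hf : ∀ x, ‖f x‖ ≤ ‖x‖) : MinTensor A B →⋆ₐ[ℂ] D where
  toRingHom := liftAux f hf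
  commutes' r := by
    rw [← (of A B).commutes]
    exact (liftAux_of f hf _).trans (AlgHomClass.commutes f r)
  map_star' x := by
    refine induction (P := fun x => liftAux f hf (star x) = star (liftAux f hf x))
      (isClosed_eq ((continuous_liftAux f hf).comp continuous_star')
        (continuous_liftAux f hf).star) (fun x => ?_) x
    rw [star_of, liftAux_of, liftAux_of, map_star]

@[simp] theorem lift_of {D : Type u} [CStarAlgebra D] (f : AlgTensor A B →⋆ₐ[ℂ] D)
    (hf : ∀ x, ‖f x‖ ≤ ‖x‖) (x : AlgTensor A B) : lift f hf (of A B x) = f x :=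
  liftAux_of f hf x

@[simp] theorem lift_tmul {D : Type u} [CStarAlgebra D] (f : AlgTensor A B →⋆ₐ[ℂ] D)
    (hf : ∀ x, ‖f x‖ ≤ ‖x‖) (a : A) (b : B) :
    lift f hf (tmul a b) = f (AlgTensor.tmul a b) := lift_of f hf _

/-- Closed additive conditions can be checked on elementary tensors. -/
theorem tmul_induction {P : MinTensor A B → Prop} (hc : IsClosed {x | P x}) (h0 : P 0)
    (ht : ∀ a b, P (tmul a b)) (hadd : ∀ x y, P x → P y → P (x + y)) (x : MinTensor A B) : P x :=
  induction hc (fun x => by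
    induction x using AlgTensor.induction with
    | h0 => rw [map_zero]; exact h0
    | ht a b => exact ht a b
    | hadd x y hx hy => rw [map_add]; exact hadd _ _ hx hy) x

theorem hom_ext {D : Type*} [CStarAlgebra D] {f g : MinTensor A B →⋆ₐ[ℂ] D}
    (h : ∀ a b, f (tmul a b) = g (tmul a b)) : f = g := by
  ext x
  exact tmul_induction (P := fun x => f x = g x) (isClosed_eq f.continuous' g.continuous')
    (by simp) h (fun x y hx hy => by rw [map_add, map_add, hx, hy]) x

theorem tmul_mul_tmul (a a' : A) (b b' : B) :
    tmul a b * tmul a' b' = tmul (a * a') (b * b') := by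
  rw [tmul, tmul, ← map_mul, AlgTensor.tmul_mul_tmul]; rfl

theorem star_tmul (a : A) (b : B) : star (tmul a b) = tmul (star a) (star b) := by
  rw [tmul, star_of, AlgTensor.star_tmul]; rfl

theorem one_def : (1 : MinTensor A B) = tmul 1 1 := ((of A B).map_one).symm

theorem add_tmul (a a' : A) (b : B) : tmul (a + a') b = tmul a b + tmul a' b := by
  simp only [tmul, AlgTensor.add_tmul, map_add]

theorem tmul_add (a : A) (b b' : B) : tmul a (b + b') = tmul a b + tmul a b' := by
  simp only [tmul, AlgTensor.tmul_add, map_add]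

theorem smul_tmul (c : ℂ) (a : A) (b : B) : tmul (c • a) b = c • tmul a b := by
  simp only [tmul, AlgTensor.smul_tmul, map_smul]

theorem tmul_smul (c : ℂ) (a : A) (b : B) : tmul a (c • b) = c • tmul a b := by
  simp only [tmul, AlgTensor.tmul_smul, map_smul]

theorem zero_tmul (b : B) : tmul (0 : A) b = 0 := by
  simpa using smul_tmul (0 : ℂ) (0 : A) b

theorem tmul_zero (a : A) : tmul a (0 : B) = 0 := by
  simpa using tmul_smul (0 : ℂ) a (0 : B)

variable (A B) in
/-- The embedding `a ↦ a ⊗ 1`. -/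
def inl : A →⋆ₐ[ℂ] MinTensor A B where
  toFun a := tmul a 1
  map_one' := one_def.symm
  map_mul' a a' := by rw [tmul_mul_tmul, mul_one]
  map_zero' := zero_tmul 1
  map_add' a a' := add_tmul a a' 1
  commutes' r := by
    rw [Algebra.algebraMap_eq_smul_one, smul_tmul, ← one_def, ← Algebra.algebraMap_eq_smul_one]
  map_star' a := by rw [star_tmul, star_one]

variable (A B) in
/-- The embedding `b ↦ 1 ⊗ b`. -/
def inr : B →⋆ₐ[ℂ] MinTensor A B where
  toFun b := tmul 1 b
  map_one' := one_def.symm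
  map_mul' b b' := by rw [tmul_mul_tmul, mul_one]
  map_zero' := tmul_zero 1
  map_add' b b' := tmul_add 1 b b'
  commutes' r := by
    rw [Algebra.algebraMap_eq_smul_one, tmul_smul, ← one_def, ← Algebra.algebraMap_eq_smul_one]
  map_star' b := by rw [star_tmul, star_one]

theorem inl_apply (a : A) : inl A B a = tmul a 1 := rfl
theorem inr_apply (b : B) : inr A B b = tmul 1 b := rfl

theorem inl_mul_inr (a : A) (b : B) : inl A B a * inr A B b = tmul a b := by
  rw [inl_apply, inr_apply, tmul_mul_tmul, mul_one, one_mul]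

theorem commute_inl_inr (a : A) (b : B) : Commute (inl A B a) (inr A B b) := by
  rw [Commute, SemiconjBy, inl_mul_inr, inl_apply, inr_apply, tmul_mul_tmul, mul_one, one_mul]

end MinTensor

namespace MinTensor

section Rep

variable {H K : Type u} [NormedAddCommGroup H] [InnerProductSpace ℂ H] [CompleteSpace H]
  [NormedAddCommGroup K] [InnerProductSpace ℂ K] [CompleteSpace K]
  (ρ : A →⋆ₐ[ℂ] (H →L[ℂ] H)) (σ : B →⋆ₐ[ℂ] (K →L[ℂ] K))

/-- The tensor product of two representations, on the minimal tensor product. -/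
def rep : MinTensor A B →⋆ₐ[ℂ] (HilbertTensor H K →L[ℂ] HilbertTensor H K) :=
  lift (AlgTensor.rep ρ σ) (AlgTensor.norm_rep_le ρ σ)

theorem rep_of (x : AlgTensor A B) : rep ρ σ (of A B x) = AlgTensor.rep ρ σ x := lift_of _ _ x

theorem rep_tmul (a : A) (b : B) : rep ρ σ (tmul a b) = HilbertTensor.op (ρ a) (σ b) :=
  (rep_of ρ σ _).trans (AlgTensor.rep_tmul ρ σ a b)

end Rep

theorem norm_le {x : MinTensor A B} {c : ℝ} (hc : 0 ≤ c)
    (h : ∀ (R : HilbertRep A) (S : HilbertRep B), ‖rep R.hom S.hom x‖ ≤ c) : ‖x‖ ≤ c := by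
  refine le_of_forall_pos_le_add fun ε hε => ?_
  obtain ⟨y, hy⟩ := (denseRange_of A B).exists_dist_lt x (half_pos hε)
  have hy' : ‖y‖ ≤ c + ε / 2 := by
    refine AlgTensor.norm_le (by positivity) fun R S => ?_
    rw [← rep_of]
    have h1 : ‖rep R.hom S.hom (of A B y) - rep R.hom S.hom x‖ ≤ ε / 2 := by
      rw [← map_sub]
      refine ((rep R.hom S.hom).norm_le' _).trans ?_
      rw [← dist_eq_norm, dist_comm]
      exact hy.le
    calc _ = ‖rep R.hom S.hom x + (rep R.hom S.hom (of A B y) - rep R.hom S.hom x)‖ := by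
          rw [add_sub_cancel (rep R.hom S.hom x)]
      _ ≤ _ := (norm_add_le _ _).trans (add_le_add (h R S) h1)
  calc ‖x‖ = ‖of A B y + (x - of A B y)‖ := by rw [add_sub_cancel]
    _ ≤ ‖of A B y‖ + ‖x - of A B y‖ := norm_add_le _ _
    _ ≤ (c + ε / 2) + ε / 2 := add_le_add (by rwa [norm_of]) (by rw [← dist_eq_norm]; exact hy.le)
    _ = c + ε := by ring

theorem eq_zero {x : MinTensor A B}
    (h : ∀ (R : HilbertRep A) (S : HilbertRep B), rep R.hom S.hom x = 0) : x = 0 :=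
  norm_le_zero_iff.1 (norm_le le_rfl fun R S => by rw [h, norm_zero])

variable {A' B' C' : Type u} [CStarAlgebra A'] [CStarAlgebra B'] [CStarAlgebra C']

/-- The `*`-homomorphism `φ ⊗ ψ` on the algebraic tensor product. -/
def algMap (φ : A →⋆ₐ[ℂ] A') (ψ : B →⋆ₐ[ℂ] B') : AlgTensor A B →⋆ₐ[ℂ] MinTensor A' B' :=
  AlgTensor.prodHom ((inl A' B').comp φ) ((inr A' B').comp ψ)
    fun a b => commute_inl_inr (φ a) (ψ b)

theorem algMap_tmul (φ : A →⋆ₐ[ℂ] A') (ψ : B →⋆ₐ[ℂ] B') (a : A) (b : B) :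
    algMap φ ψ (AlgTensor.tmul a b) = tmul (φ a) (ψ b) :=
  (AlgTensor.prodHom_tmul _ _ _ a b).trans (inl_mul_inr (φ a) (ψ b))

theorem rep_algMap {H K : Type u} [NormedAddCommGroup H] [InnerProductSpace ℂ H]
    [CompleteSpace H] [NormedAddCommGroup K] [InnerProductSpace ℂ K] [CompleteSpace K]
    (φ : A →⋆ₐ[ℂ] A') (ψ : B →⋆ₐ[ℂ] B') (ρ : A' →⋆ₐ[ℂ] (H →L[ℂ] H))
    (σ : B' →⋆ₐ[ℂ] (K →L[ℂ] K)) (x : AlgTensor A B) :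
    rep ρ σ (algMap φ ψ x) = AlgTensor.rep (ρ.comp φ) (σ.comp ψ) x := by
  induction x using AlgTensor.induction with
  | h0 => rw [map_zero, map_zero, map_zero]
  | ht a b => rw [algMap_tmul, rep_tmul, AlgTensor.rep_tmul]; rfl
  | hadd x y hx hy => rw [map_add, map_add, map_add, hx, hy]

/-- The `*`-homomorphism `φ ⊗ ψ` between minimal tensor products. -/
def map (φ : A →⋆ₐ[ℂ] A') (ψ : B →⋆ₐ[ℂ] B') : MinTensor A B →⋆ₐ[ℂ] MinTensor A' B' :=
  lift (algMap φ ψ) fun x => norm_le (norm_nonneg _) fun R S => by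
    rw [rep_algMap]
    exact AlgTensor.norm_rep_le _ _ x

@[simp] theorem map_tmul (φ : A →⋆ₐ[ℂ] A') (ψ : B →⋆ₐ[ℂ] B') (a : A) (b : B) :
    map φ ψ (tmul a b) = tmul (φ a) (ψ b) := by
  rw [map, lift_tmul, algMap_tmul]

theorem map_map {A'' B'' : Type u} [CStarAlgebra A''] [CStarAlgebra B'']
    (φ : A →⋆ₐ[ℂ] A') (ψ : B →⋆ₐ[ℂ] B') (φ' : A' →⋆ₐ[ℂ] A'') (ψ' : B' →⋆ₐ[ℂ] B'')
    (x : MinTensor A B) : map φ' ψ' (map φ ψ x) = map (φ'.comp φ) (ψ'.comp ψ) x := by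
  have : (map φ' ψ').comp (map φ ψ) = map (φ'.comp φ) (ψ'.comp ψ) := by
    apply hom_ext; intro a b; simp
  exact DFunLike.congr_fun this x

end MinTensor

end Functoriality

section Gns

open scoped ComplexOrder

variable {A : Type u} [CStarAlgebra A]

/-- The Gelfand-Naimark-Segal representation of a positive linear functional. -/
theorem exists_gns (φ : A →ₗ[ℂ] ℂ) (hφ : ∀ a, 0 ≤ φ (star a * a)) :
    ∃ (R : HilbertRep A) (Ω : R.H), (∀ a, inner ℂ Ω (R.hom a Ω) = φ a) ∧
      DenseRange fun a => R.hom a Ω := by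
  let _ : PartialOrder A := CStarAlgebra.spectralOrder A
  let _ : StarOrderedRing A := CStarAlgebra.spectralOrderedRing A
  let f : A →ₚ[ℂ] ℂ := PositiveLinearMap.mk₀ φ (by
    intro x hx
    obtain ⟨b, rfl⟩ := CStarAlgebra.nonneg_iff_eq_star_mul_self.mp hx
    exact hφ b)
  have hf : ∀ a, f a = φ a := fun a => rfl
  have key : ∀ a, f.gnsStarAlgHom a ((f.toPreGNS 1 : f.PreGNS) : f.GNS) =
      ((f.toPreGNS a : f.PreGNS) : f.GNS) := by
    intro a
    simp
  refine ⟨⟨f.GNS, f.gnsStarAlgHom⟩, ((f.toPreGNS 1 : f.PreGNS) : f.GNS), ?_, ?_⟩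
  · intro a
    change inner ℂ _ (f.gnsStarAlgHom a ((f.toPreGNS 1 : f.PreGNS) : f.GNS)) = _
    rw [key, UniformSpace.Completion.inner_coe, PositiveLinearMap.preGNS_inner_def]
    simp [hf]
  · have : (fun a => f.gnsStarAlgHom a ((f.toPreGNS 1 : f.PreGNS) : f.GNS)) =
        ((↑) : f.PreGNS → f.GNS) ∘ f.toPreGNS := funext key
    change DenseRange (fun a => f.gnsStarAlgHom a ((f.toPreGNS 1 : f.PreGNS) : f.GNS))
    rw [this]
    exact UniformSpace.Completion.denseRange_coe.comp f.toPreGNS.surjective.denseRange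
      (UniformSpace.Completion.continuous_coe _)

/-- The representations of a C*-algebra on Hilbert spaces determine its norm. -/
theorem norm_le_of_forall_rep {a : A} {c : ℝ} (hc : 0 ≤ c)
    (h : ∀ R : HilbertRep A, ‖R.hom a‖ ≤ c) : ‖a‖ ≤ c := by
  let _ : PartialOrder A := CStarAlgebra.spectralOrder A
  let _ : StarOrderedRing A := CStarAlgebra.spectralOrderedRing A
  by_contra hlt
  rw [not_le] at hlt
  set y : A := algebraMap ℝ A (c ^ 2) - star a * a with hy
  have hy0 : y ∉ ProperCone.positive ℝ A := by
    intro hmem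
    have h0 : 0 ≤ y := hmem
    rw [hy, sub_nonneg, ← CStarAlgebra.norm_le_iff_le_algebraMap _ (by positivity)
      (star_mul_self_nonneg a), CStarRing.norm_star_mul_self, ← sq] at h0
    exact absurd h0 (not_le.2 (pow_lt_pow_left₀ hlt hc two_ne_zero))
  obtain ⟨f, hf, hfy⟩ := ProperCone.hyperplane_separation_point _ hy0
  let g : A →ₗ[ℝ] ℝ := f.toLinearMap ∘ₗ (selfAdjoint.submodule ℝ A).subtype ∘ₗ realPart
  have hgd : ∀ x, g x = f (realPart x : A) := fun x => rfl
  have hg : ∀ x, IsSelfAdjoint x → g x = f x := fun x hx => by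
    rw [hgd, hx.coe_realPart]
  let φ : A →ₗ[ℂ] ℂ := Module.Dual.extendRCLike g
  have hφ : ∀ x, IsSelfAdjoint x → φ x = f x := fun x hx => by
    have h0 : g (Complex.I • x) = 0 := by
      rw [hgd, realPart_I_smul, hx.imaginaryPart]; simp
    change (Module.Dual.extendRCLike g : A →ₗ[ℂ] ℂ) x = f x
    rw [Module.Dual.extendRCLike_apply]
    change ((g x : ℂ) - Complex.I * (g (Complex.I • x) : ℂ)) = f x
    rw [h0, hg x hx]; simp
  obtain ⟨R, Ω, hR, -⟩ := exists_gns φ fun x => by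
    rw [hφ _ (IsSelfAdjoint.star_mul_self x)]
    exact_mod_cast hf _ (star_mul_self_nonneg x)
  have hysa : IsSelfAdjoint y := by
    rw [hy]
    exact (IsSelfAdjoint.algebraMap A (IsSelfAdjoint.all _)).sub (IsSelfAdjoint.star_mul_self a)
  have h1 : inner ℂ Ω (R.hom y Ω) = ((c ^ 2 * ‖Ω‖ ^ 2 - ‖R.hom a Ω‖ ^ 2 : ℝ) : ℂ) := by
    have h2 : R.hom (algebraMap ℝ A (c ^ 2)) = ((c ^ 2 : ℝ) : ℂ) • 1 := by
      rw [Algebra.algebraMap_eq_smul_one, ← Complex.coe_smul, map_smul, map_one]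
    have h3 : inner ℂ Ω (R.hom (star a * a) Ω) = ((‖R.hom a Ω‖ ^ 2 : ℝ) : ℂ) := by
      rw [map_mul, map_star, mul_apply_eq_comp, ContinuousLinearMap.star_eq_adjoint,
        ContinuousLinearMap.adjoint_inner_right, inner_self_eq_norm_sq_to_K]
      simp
    rw [hy, map_sub, sub_apply, inner_sub_right, h3, h2,
      smul_apply, one_apply_eq_self, inner_smul_right,
      inner_self_eq_norm_sq_to_K]
    simp
  rw [hR, hφ y hysa] at h1
  have h2 : c ^ 2 * ‖Ω‖ ^ 2 - ‖R.hom a Ω‖ ^ 2 < 0 := by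
    have := Complex.ofReal_injective h1
    rw [← this]
    exact hfy
  have h3 : ‖R.hom a Ω‖ ≤ c * ‖Ω‖ :=
    ((R.hom a).le_opNorm Ω).trans (mul_le_mul_of_nonneg_right (h R) (norm_nonneg _))
  nlinarith [norm_nonneg (R.hom a Ω)]

end Gns

section Faithfulness

open scoped ENNReal

/-- A jointly injective family of `*`-homomorphisms of C*-algebras determines the norm. -/
theorem norm_le_of_jointly_injective {D : Type*} [CStarAlgebra D] {ι : Type*} {E : ι → Type*}
    [∀ i, CStarAlgebra (E i)] (f : ∀ i, D →⋆ₐ[ℂ] E i)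
    (hinj : ∀ x, (∀ i, f i x = 0) → x = 0) {x : D} {c : ℝ} (hc : 0 ≤ c)
    (h : ∀ i, ‖f i x‖ ≤ c) : ‖x‖ ≤ c := by
  have hmem : ∀ y : D, Memℓp (fun i => f i y) ∞ := fun y =>
    memℓp_infty ⟨‖y‖, by rintro _ ⟨i, rfl⟩; exact (f i).norm_le' y⟩
  let g : D →⋆ₙₐ[ℂ] lp E ∞ :=
    { toFun := fun y => ⟨fun i => f i y, hmem y⟩
      map_smul' := fun r y => by ext i; exact map_smul (f i) r y
      map_zero' := by ext i; exact map_zero (f i)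
      map_add' := fun y z => by ext i; exact map_add (f i) y z
      map_mul' := fun y z => by ext i; exact map_mul (f i) y z
      map_star' := fun y => by ext i; exact map_star (f i) y }
  have hg : Function.Injective g := by
    refine (injective_iff_map_eq_zero g).2 fun y hy => hinj y fun i => ?_
    have h1 : (g y : ∀ i, E i) i = 0 := by rw [hy]; rfl
    exact h1
  rw [← NonUnitalStarAlgHom.norm_map g hg x]
  exact lp.norm_le_of_forall_le hc h

variable {A B : Type u} [CStarAlgebra A] [CStarAlgebra B]

theorem AlgTensor.inner_rep_le {H K : Type u} [NormedAddCommGroup H] [InnerProductSpace ℂ H]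
    [CompleteSpace H] [NormedAddCommGroup K] [InnerProductSpace ℂ K] [CompleteSpace K]
    (ρ : A →⋆ₐ[ℂ] (H →L[ℂ] H)) (σ : B →⋆ₐ[ℂ] (K →L[ℂ] K)) (x : AlgTensor A B)
    (v v' : H) (w w' : K) :
    ‖inner ℂ (HilbertTensor.vec v' w') (rep ρ σ x (HilbertTensor.vec v w))‖ ≤
      ‖v'‖ * ‖w'‖ * (‖x‖ * (‖v‖ * ‖w‖)) := by
  refine (norm_inner_le_norm _ _).trans ?_
  rw [HilbertTensor.norm_vec, ← HilbertTensor.norm_vec v w]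
  refine mul_le_mul_of_nonneg_left ?_ (by positivity)
  exact ((rep ρ σ x).le_opNorm _).trans
    (mul_le_mul_of_nonneg_right (norm_rep_le ρ σ x) (norm_nonneg _))

theorem norm_le_of_inner {H : Type*} [NormedAddCommGroup H] [InnerProductSpace ℂ H]
    {T : H →L[ℂ] H} {c : ℝ} (hc : 0 ≤ c) (h : ∀ v v', ‖inner ℂ v' (T v)‖ ≤ c * ‖v‖ * ‖v'‖) :
    ‖T‖ ≤ c := by
  refine T.opNorm_le_bound hc fun v => ?_
  have h1 := h v (T v)
  rw [inner_self_eq_norm_sq_to_K, norm_pow, RCLike.norm_ofReal, abs_norm, sq] at h1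
  rcases (norm_nonneg (T v)).eq_or_lt with h0 | h0
  · rw [← h0]; positivity
  · exact le_of_mul_le_mul_right h1 h0

namespace MinTensor

/-- The inclusion of the algebraic tensor product as a continuous linear map. -/
def ofL (A B : Type u) [CStarAlgebra A] [CStarAlgebra B] : AlgTensor A B →L[ℂ] MinTensor A B :=
  ⟨(of A B).toLinearMap, (isometry_of A B).continuous⟩

/-- Slicing the right leg by a vector functional. -/
theorem exists_slice_right {K : Type u} [NormedAddCommGroup K] [InnerProductSpace ℂ K]
    [CompleteSpace K] (σ : B →⋆ₐ[ℂ] (K →L[ℂ] K)) (w w' : K) (x : MinTensor A B) :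
    ∃ a : A, ∀ (R : HilbertRep A) (v v' : R.H), inner ℂ v' (R.hom a v) =
      inner ℂ (HilbertTensor.vec v' w') (rep R.hom σ x (HilbertTensor.vec v w)) := by
  let s₀ : AlgTensor A B →ₗ[ℂ] A := (TensorProduct.lift (LinearMap.mk₂ ℂ
    (fun (a : A) (b : B) => (inner ℂ w' (σ b w) : ℂ) • a)
    (fun a a' b => smul_add _ a a') (fun c a b => smul_comm _ c a)
    (fun a b b' => by simp [inner_add_right, add_smul])
    (fun c a b => by simp [inner_smul_right, mul_smul])) : A ⊗[ℂ] B →ₗ[ℂ] A)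
  have hs₀ : ∀ a b, s₀ (AlgTensor.tmul a b) = (inner ℂ w' (σ b w) : ℂ) • a := fun a b => rfl
  have key : ∀ (y : AlgTensor A B) (R : HilbertRep A) (v v' : R.H),
      inner ℂ v' (R.hom (s₀ y) v) = inner ℂ (HilbertTensor.vec v' w')
        (AlgTensor.rep R.hom σ y (HilbertTensor.vec v w)) := by
    intro y R v v'
    induction y using AlgTensor.induction with
    | h0 => simp
    | ht a b =>
      rw [hs₀, AlgTensor.rep_tmul, HilbertTensor.op_vec, HilbertTensor.inner_vec, map_smul,
        smul_apply, inner_smul_right, mul_comm]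
    | hadd y z hy hz => simp only [map_add, add_apply, inner_add_right, hy, hz]
  have hbound : ∀ y, ‖s₀ y‖ ≤ (‖w‖ * ‖w'‖) * ‖y‖ := fun y =>
    norm_le_of_forall_rep (by positivity) fun R => norm_le_of_inner (by positivity)
      fun v v' => by
        rw [key]
        exact (AlgTensor.inner_rep_le R.hom σ y v v' w w').trans (le_of_eq (by ring))
  let s : MinTensor A B →L[ℂ] A := (s₀.mkContinuous _ hbound).extend (ofL A B)
  have hs : ∀ y, s (of A B y) = s₀ y := fun y =>
    ContinuousLinearMap.extend_eq (e := ofL A B) _ (denseRange_of A B)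
      (isometry_of A B).isUniformInducing y
  refine ⟨s x, fun R v v' => ?_⟩
  refine induction (P := fun x => inner ℂ v' (R.hom (s x) v) = inner ℂ (HilbertTensor.vec v' w')
    (rep R.hom σ x (HilbertTensor.vec v w))) (isClosed_eq ?_ ?_) (fun y => ?_) x
  · exact continuous_const.inner
      (((R.hom.continuous'.comp s.continuous)).clm_apply continuous_const)
  · exact continuous_const.inner ((rep R.hom σ).continuous'.clm_apply continuous_const)
  · rw [hs, rep_of, key]

/-- Slicing the left leg by a vector functional. -/
theorem exists_slice_left {H : Type u} [NormedAddCommGroup H] [InnerProductSpace ℂ H]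
    [CompleteSpace H] (ρ : A →⋆ₐ[ℂ] (H →L[ℂ] H)) (v v' : H) (x : MinTensor A B) :
    ∃ b : B, ∀ (S : HilbertRep B) (w w' : S.H), inner ℂ w' (S.hom b w) =
      inner ℂ (HilbertTensor.vec v' w') (rep ρ S.hom x (HilbertTensor.vec v w)) := by
  let s₀ : AlgTensor A B →ₗ[ℂ] B := (TensorProduct.lift (LinearMap.mk₂ ℂ
    (fun (a : A) (b : B) => (inner ℂ v' (ρ a v) : ℂ) • b)
    (fun a a' b => by simp [inner_add_right, add_smul])
    (fun c a b => by simp [inner_smul_right, mul_smul])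
    (fun a b b' => smul_add _ b b')
    (fun c a b => smul_comm _ c b)) : A ⊗[ℂ] B →ₗ[ℂ] B)
  have hs₀ : ∀ a b, s₀ (AlgTensor.tmul a b) = (inner ℂ v' (ρ a v) : ℂ) • b := fun a b => rfl
  have key : ∀ (y : AlgTensor A B) (S : HilbertRep B) (w w' : S.H),
      inner ℂ w' (S.hom (s₀ y) w) = inner ℂ (HilbertTensor.vec v' w')
        (AlgTensor.rep ρ S.hom y (HilbertTensor.vec v w)) := by
    intro y S w w'
    induction y using AlgTensor.induction with
    | h0 => simp
    | ht a b =>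
      rw [hs₀, AlgTensor.rep_tmul, HilbertTensor.op_vec, HilbertTensor.inner_vec, map_smul,
        smul_apply, inner_smul_right]
    | hadd y z hy hz => simp only [map_add, add_apply, inner_add_right, hy, hz]
  have hbound : ∀ y, ‖s₀ y‖ ≤ (‖v‖ * ‖v'‖) * ‖y‖ := fun y =>
    norm_le_of_forall_rep (by positivity) fun S => norm_le_of_inner (by positivity)
      fun w w' => by
        rw [key]
        exact (AlgTensor.inner_rep_le ρ S.hom y v v' w w').trans (le_of_eq (by ring))
  let s : MinTensor A B →L[ℂ] B := (s₀.mkContinuous _ hbound).extend (ofL A B)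
  have hs : ∀ y, s (of A B y) = s₀ y := fun y =>
    ContinuousLinearMap.extend_eq (e := ofL A B) _ (denseRange_of A B)
      (isometry_of A B).isUniformInducing y
  refine ⟨s x, fun S w w' => ?_⟩
  refine induction (P := fun x => inner ℂ w' (S.hom (s x) w) = inner ℂ (HilbertTensor.vec v' w')
    (rep ρ S.hom x (HilbertTensor.vec v w))) (isClosed_eq ?_ ?_) (fun y => ?_) x
  · exact continuous_const.inner
      (((S.hom.continuous'.comp s.continuous)).clm_apply continuous_const)
  · exact continuous_const.inner ((rep ρ S.hom).continuous'.clm_apply continuous_const)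
  · rw [hs, rep_of, key]

/-- Jointly faithful families of representations of the factors define a jointly faithful family
of representations of the minimal tensor product. -/
theorem eq_zero_of_faithful (𝓡 : Set (HilbertRep A)) (𝓢 : Set (HilbertRep B))
    (h𝓡 : ∀ a, (∀ R ∈ 𝓡, R.hom a = 0) → a = 0) (h𝓢 : ∀ b, (∀ S ∈ 𝓢, S.hom b = 0) → b = 0)
    {x : MinTensor A B} (h : ∀ R ∈ 𝓡, ∀ S ∈ 𝓢, rep R.hom S.hom x = 0) : x = 0 := by
  have h1 : ∀ (R : HilbertRep A), ∀ S ∈ 𝓢, rep R.hom S.hom x = 0 := by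
    intro R S hS
    apply HilbertTensor.ext_inner_op
    intro v w v' w'
    obtain ⟨a, ha⟩ := exists_slice_right S.hom w w' x
    have ha0 : a = 0 := by
      refine h𝓡 a fun R' hR' => ?_
      ext u
      refine ext_inner_left ℂ fun u' => ?_
      rw [ha R' u u', h R' hR' S hS]
      simp
    rw [← ha R v v', ha0]
    simp
  refine eq_zero fun R S => ?_
  apply HilbertTensor.ext_inner_op
  intro v w v' w'
  obtain ⟨b, hb⟩ := exists_slice_left R.hom v v' x
  have hb0 : b = 0 := by
    refine h𝓢 b fun S' hS' => ?_
    ext u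
    refine ext_inner_left ℂ fun u' => ?_
    rw [hb S' u u', h1 R S' hS']
    simp
  rw [← hb S w w', hb0]
  simp

end MinTensor

end Faithfulness

section Associativity

namespace HilbertTensor

variable (H K L : Type u) [NormedAddCommGroup H] [InnerProductSpace ℂ H]
  [NormedAddCommGroup K] [InnerProductSpace ℂ K] [NormedAddCommGroup L] [InnerProductSpace ℂ L]

theorem continuous_vec {H K : Type u} [NormedAddCommGroup H] [InnerProductSpace ℂ H]
    [NormedAddCommGroup K] [InnerProductSpace ℂ K] (v : H) :
    Continuous (fun w : K => vec v w) :=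
  (incl H K).continuous.comp (TensorProduct.continuous_tmul.comp
    (continuous_const.prodMk continuous_id))

/-- Inclusion of the algebraic triple tensor product. -/
def inclRight : (H ⊗[ℂ] (K ⊗[ℂ] L)) →ₗᵢ[ℂ] HilbertTensor H (HilbertTensor K L) :=
  (incl H (HilbertTensor K L)).comp (TensorProduct.mapIsometry LinearIsometry.id (incl K L))

/-- Inclusion of the algebraic triple tensor product. -/
def inclLeft : (H ⊗[ℂ] (K ⊗[ℂ] L)) →ₗᵢ[ℂ] HilbertTensor (HilbertTensor H K) L :=
  ((incl (HilbertTensor H K) L).comp (TensorProduct.mapIsometry (incl H K) LinearIsometry.id)).comp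
    (TensorProduct.assocIsometry ℂ H K L).symm.toLinearIsometry

variable {H K L}

theorem inclRight_tmul (h : H) (k : K) (l : L) :
    inclRight H K L (h ⊗ₜ (k ⊗ₜ l)) = vec h (vec k l) := rfl

theorem inclLeft_tmul (h : H) (k : K) (l : L) :
    inclLeft H K L (h ⊗ₜ (k ⊗ₜ l)) = vec (vec h k) l := rfl

/-- Closed additive conditions can be checked on elementary triple tensors. -/
theorem vec_induction₃ {P : HilbertTensor H (HilbertTensor K L) → Prop}
    (hc : IsClosed {x | P x}) (h0 : P 0) (hadd : ∀ x y, P x → P y → P (x + y))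
    (hv : ∀ h k l, P (vec h (vec k l))) (x : HilbertTensor H (HilbertTensor K L)) : P x := by
  refine vec_induction hc h0 hadd (fun v w => ?_) x
  refine vec_induction (P := fun w => P (vec v w)) (hc.preimage (continuous_vec v)) ?_ ?_ ?_ w
  · have : vec v (0 : HilbertTensor K L) = 0 := by
      simpa using vec_smul_right (0 : ℂ) v (0 : HilbertTensor K L)
    rw [this]; exact h0
  · intro y z hy hz
    rw [vec_add_right]; exact hadd _ _ hy hz
  · exact hv v

theorem denseRange_inclRight : DenseRange (inclRight H K L) := by
  intro x
  have hcl : ((LinearMap.range (inclRight H K L).toLinearMap).topologicalClosure : Set _) =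
    closure (Set.range (inclRight H K L)) := by
    rw [Submodule.topologicalClosure_coe]; rfl
  rw [← hcl]
  refine vec_induction₃
    (P := fun x => x ∈ (LinearMap.range (inclRight H K L).toLinearMap).topologicalClosure)
    (Submodule.isClosed_topologicalClosure _) (Submodule.zero_mem _)
    (fun _ _ => Submodule.add_mem _) (fun h k l => ?_) x
  exact Submodule.le_topologicalClosure _ ⟨h ⊗ₜ (k ⊗ₜ l), inclRight_tmul h k l⟩

variable (H K L) in
/-- The isometry `h ⊗ (k ⊗ l) ↦ (h ⊗ k) ⊗ l`. -/
def assocInv : HilbertTensor H (HilbertTensor K L) →L[ℂ] HilbertTensor (HilbertTensor H K) L :=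
  (inclLeft H K L).toContinuousLinearMap.extend (inclRight H K L).toContinuousLinearMap

theorem assocInv_inclRight (x : H ⊗[ℂ] (K ⊗[ℂ] L)) :
    assocInv H K L (inclRight H K L x) = inclLeft H K L x :=
  ContinuousLinearMap.extend_eq (e := (inclRight H K L).toContinuousLinearMap) _
    denseRange_inclRight (inclRight H K L).isometry.isUniformInducing x

theorem assocInv_vec (h : H) (k : K) (l : L) :
    assocInv H K L (vec h (vec k l)) = vec (vec h k) l := by
  rw [← inclRight_tmul, assocInv_inclRight, inclLeft_tmul]

theorem norm_assocInv (x : HilbertTensor H (HilbertTensor K L)) : ‖assocInv H K L x‖ = ‖x‖ := by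
  refine denseRange_inclRight.induction_on x (isClosed_eq (by fun_prop) (by fun_prop)) fun y => ?_
  rw [assocInv_inclRight, LinearIsometry.norm_map, LinearIsometry.norm_map]

end HilbertTensor

namespace MinTensor

variable (A B C : Type u) [CStarAlgebra A] [CStarAlgebra B] [CStarAlgebra C]

theorem commute_assoc (x : MinTensor A B) (c : C) :
    Commute (map (StarAlgHom.id ℂ A) (inl B C) x)
      ((inr A (MinTensor B C)).comp (inr B C) c) := by
  refine tmul_induction (P := fun x => Commute (map (StarAlgHom.id ℂ A) (inl B C) x)
      ((inr A (MinTensor B C)).comp (inr B C) c)) ?_ ?_ ?_ ?_ x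
  · exact isClosed_eq ((map (StarAlgHom.id ℂ A) (inl B C)).continuous'.mul continuous_const)
      (continuous_const.mul (map (StarAlgHom.id ℂ A) (inl B C)).continuous')
  · rw [map_zero]; exact Commute.zero_left _
  · intro a b
    rw [map_tmul, StarAlgHom.comp_apply, inr_apply, Commute, SemiconjBy, tmul_mul_tmul,
      tmul_mul_tmul, (commute_inl_inr b c).eq]
    simp
  · intro x y hx hy
    rw [map_add]; exact hx.add_left hy

/-- The homomorphism `(a ⊗ b) ⊗ c ↦ a ⊗ (b ⊗ c)`, before completion of the outer tensor product. -/
def assocAlg : AlgTensor (MinTensor A B) C →⋆ₐ[ℂ] MinTensor A (MinTensor B C) :=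
  AlgTensor.prodHom (map (StarAlgHom.id ℂ A) (inl B C)) ((inr A (MinTensor B C)).comp (inr B C))
    (commute_assoc A B C)

variable {A B C}

theorem assocAlg_tmul (x : MinTensor A B) (c : C) :
    assocAlg A B C (AlgTensor.tmul x c) =
      map (StarAlgHom.id ℂ A) (inl B C) x * tmul 1 (tmul 1 c) :=
  AlgTensor.prodHom_tmul _ _ _ x c

theorem assocAlg_tmul_tmul (a : A) (b : B) (c : C) :
    assocAlg A B C (AlgTensor.tmul (tmul a b) c) = tmul a (tmul b c) := by
  rw [assocAlg_tmul, map_tmul, tmul_mul_tmul, inl_apply, tmul_mul_tmul]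
  simp

section

variable {H K L : Type u} [NormedAddCommGroup H] [InnerProductSpace ℂ H] [CompleteSpace H]
  [NormedAddCommGroup K] [InnerProductSpace ℂ K] [CompleteSpace K]
  [NormedAddCommGroup L] [InnerProductSpace ℂ L] [CompleteSpace L]
  (ρ : A →⋆ₐ[ℂ] (H →L[ℂ] H)) (σ : B →⋆ₐ[ℂ] (K →L[ℂ] K)) (τ : C →⋆ₐ[ℂ] (L →L[ℂ] L))

theorem assocInv_rep (x : MinTensor A B) (c : C) (v : HilbertTensor H (HilbertTensor K L)) :
    HilbertTensor.assocInv H K L (rep ρ (rep σ τ) (assocAlg A B C (AlgTensor.tmul x c)) v) =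
      HilbertTensor.op (rep ρ σ x) (τ c) (HilbertTensor.assocInv H K L v) := by
  refine tmul_induction (P := fun x => HilbertTensor.assocInv H K L
    (rep ρ (rep σ τ) (assocAlg A B C (AlgTensor.tmul x c)) v) =
      HilbertTensor.op (rep ρ σ x) (τ c) (HilbertTensor.assocInv H K L v)) ?_ ?_ ?_ ?_ x
  · refine isClosed_eq ?_ ?_
    · simp only [assocAlg_tmul]
      refine (HilbertTensor.assocInv H K L).continuous.comp
        (Continuous.clm_apply ?_ continuous_const)
      exact (rep ρ (rep σ τ)).continuous'.comp
        ((map (StarAlgHom.id ℂ A) (inl B C)).continuous'.mul continuous_const)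
    · refine Continuous.clm_apply ?_ continuous_const
      have hL : Continuous fun T : HilbertTensor H K →L[ℂ] HilbertTensor H K =>
          HilbertTensor.op T (τ c) :=
        (LinearMap.mkContinuous
          (⟨⟨fun T => HilbertTensor.op T (τ c), fun T T' => HilbertTensor.op_add_left _ _ _⟩,
            fun r T => HilbertTensor.op_smul_left _ _ _⟩ :
            (HilbertTensor H K →L[ℂ] HilbertTensor H K) →ₗ[ℂ] _) ‖τ c‖
          (fun T => (HilbertTensor.norm_op_le _ _).trans (le_of_eq (mul_comm _ _)))).continuous
      exact hL.comp (rep ρ σ).continuous'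
  · have h1 : HilbertTensor.op (0 : HilbertTensor H K →L[ℂ] HilbertTensor H K) (τ c) = 0 := by
      simpa using HilbertTensor.op_smul_left (0 : ℂ)
        (0 : HilbertTensor H K →L[ℂ] HilbertTensor H K) (τ c)
    rw [assocAlg_tmul, map_zero, zero_mul, map_zero, map_zero, h1]
    simp
  · intro a b
    rw [assocAlg_tmul_tmul, rep_tmul, rep_tmul, rep_tmul]
    refine HilbertTensor.vec_induction₃ (P := fun v => HilbertTensor.assocInv H K L
      (HilbertTensor.op (ρ a) (HilbertTensor.op (σ b) (τ c)) v) =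
      HilbertTensor.op (HilbertTensor.op (ρ a) (σ b)) (τ c) (HilbertTensor.assocInv H K L v))
      (isClosed_eq (by fun_prop) (by fun_prop)) (by simp)
      (fun v w hv hw => by simp only [map_add, hv, hw]) (fun h k l => ?_) v
    simp [HilbertTensor.assocInv_vec]
  · intro x y hx hy
    have : (AlgTensor.tmul (x + y) c) = AlgTensor.tmul x c + AlgTensor.tmul y c :=
      AlgTensor.add_tmul x y c
    rw [this, map_add, map_add, add_apply, map_add, hx, hy, map_add, HilbertTensor.op_add_left,
      add_apply]

theorem norm_rep_assocAlg_le (z : AlgTensor (MinTensor A B) C) :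
    ‖rep ρ (rep σ τ) (assocAlg A B C z)‖ ≤ ‖z‖ := by
  have key : ∀ v, HilbertTensor.assocInv H K L (rep ρ (rep σ τ) (assocAlg A B C z) v) =
      AlgTensor.rep (rep ρ σ) τ z (HilbertTensor.assocInv H K L v) := by
    intro v
    induction z using AlgTensor.induction with
    | h0 => simp
    | ht x c => rw [AlgTensor.rep_tmul, assocInv_rep]
    | hadd x y hx hy => simp only [map_add, add_apply, hx, hy]
  refine ContinuousLinearMap.opNorm_le_bound _ (norm_nonneg _) fun v => ?_
  rw [← HilbertTensor.norm_assocInv, key]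
  refine ((AlgTensor.rep (rep ρ σ) τ z).le_opNorm _).trans ?_
  rw [HilbertTensor.norm_assocInv]
  exact mul_le_mul_of_nonneg_right (AlgTensor.norm_rep_le _ _ z) (norm_nonneg _)

end

theorem norm_assocAlg_le (z : AlgTensor (MinTensor A B) C) : ‖assocAlg A B C z‖ ≤ ‖z‖ := by
  refine norm_le_of_jointly_injective
    (ι := HilbertRep A × HilbertRep B × HilbertRep C)
    (fun i => rep i.1.hom (rep i.2.1.hom i.2.2.hom)) ?_ (norm_nonneg _)
    (fun i => norm_rep_assocAlg_le _ _ _ z)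
  intro x hx
  refine eq_zero_of_faithful Set.univ
    (Set.range fun p : HilbertRep B × HilbertRep C =>
      (⟨HilbertTensor p.1.H p.2.H, rep p.1.hom p.2.hom⟩ : HilbertRep (MinTensor B C))) ?_ ?_ ?_
  · intro a ha
    exact norm_le_zero_iff.1 (norm_le_of_forall_rep le_rfl fun R => by
      rw [ha R (Set.mem_univ R), norm_zero])
  · intro y hy
    exact eq_zero fun S T => hy _ ⟨(S, T), rfl⟩
  · rintro R - _ ⟨p, rfl⟩
    exact hx (R, p.1, p.2)

variable (A B C) in
/-- The canonical homomorphism `(A ⊗ B) ⊗ C → A ⊗ (B ⊗ C)`, `(a ⊗ b) ⊗ c ↦ a ⊗ (b ⊗ c)`. -/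
def assoc : MinTensor (MinTensor A B) C →⋆ₐ[ℂ] MinTensor A (MinTensor B C) :=
  lift (assocAlg A B C) norm_assocAlg_le

@[simp] theorem assoc_tmul (a : A) (b : B) (c : C) :
    assoc A B C (tmul (tmul a b) c) = tmul a (tmul b c) := by
  rw [assoc, lift_tmul, assocAlg_tmul_tmul]

theorem hom_ext₃ {D : Type*} [CStarAlgebra D] {f g : MinTensor (MinTensor A B) C →⋆ₐ[ℂ] D}
    (h : ∀ a b c, f (tmul (tmul a b) c) = g (tmul (tmul a b) c)) : f = g := by
  apply hom_ext
  intro x c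
  rw [← inl_mul_inr, map_mul, map_mul]
  have h1 : f.comp (inl (MinTensor A B) C) = g.comp (inl (MinTensor A B) C) := by
    apply hom_ext
    intro a b
    exact h a b 1
  have h2 : f (inr (MinTensor A B) C c) = g (inr (MinTensor A B) C c) := by
    rw [inr_apply, one_def]; exact h 1 1 c
  rw [h2]
  exact congrArg (· * _) (DFunLike.congr_fun h1 x)

theorem assoc_map {A' B' C' : Type u} [CStarAlgebra A'] [CStarAlgebra B'] [CStarAlgebra C']
    (φ : A →⋆ₐ[ℂ] A') (ψ : B →⋆ₐ[ℂ] B') (χ : C →⋆ₐ[ℂ] C') (x : MinTensor (MinTensor A B) C) :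
    assoc A' B' C' (map (map φ ψ) χ x) = map φ (map ψ χ) (assoc A B C x) := by
  have : (assoc A' B' C').comp (map (map φ ψ) χ) = (map φ (map ψ χ)).comp (assoc A B C) := by
    apply hom_ext₃; intro a b c; simp
  exact DFunLike.congr_fun this x

end MinTensor

end Associativity

section KacIdeal

open scoped ComplexOrder

/-- A tracial state on a unital C*-algebra. -/
structure TracialState (A : Type*) [CStarAlgebra A] where
  /-- The underlying linear functional. -/
  toLinearMap : A →ₗ[ℂ] ℂ
  nonneg : ∀ a, 0 ≤ toLinearMap (star a * a)
  map_one : toLinearMap 1 = 1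
  tracial : ∀ a b, toLinearMap (a * b) = toLinearMap (b * a)

instance {A : Type*} [CStarAlgebra A] : CoeFun (TracialState A) fun _ => A → ℂ :=
  ⟨fun τ => τ.toLinearMap⟩

variable {B : Type u} [CStarAlgebra B]

theorem inner_hom_star_mul_self (R : HilbertRep B) (Ω : R.H) (a b : B) :
    inner ℂ Ω (R.hom (star a * b) Ω) = inner ℂ (R.hom a Ω) (R.hom b Ω) := by
  rw [map_mul, map_star, mul_apply_eq_comp, ContinuousLinearMap.star_eq_adjoint,
    ContinuousLinearMap.adjoint_inner_right]

namespace TracialState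

theorem exists_rep (τ : TracialState B) :
    ∃ (R : HilbertRep B) (Ω : R.H), (∀ a, inner ℂ Ω (R.hom a Ω) = τ a) ∧
      DenseRange fun a => R.hom a Ω :=
  exists_gns τ.toLinearMap τ.nonneg

theorem apply_star_mul_self_eq_zero_iff {τ : TracialState B} {R : HilbertRep B} {Ω : R.H}
    (h : ∀ a, inner ℂ Ω (R.hom a Ω) = τ a) (b : B) : τ (star b * b) = 0 ↔ R.hom b Ω = 0 := by
  rw [← h, inner_hom_star_mul_self, inner_self_eq_zero]

end TracialState

variable (B) in
/-- The intersection of the left kernels of all tracial states. If there is no tracial state, this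
is the whole algebra. -/
def kacIdeal : Ideal B where
  carrier := {b | ∀ τ : TracialState B, τ (star b * b) = 0}
  zero_mem' τ := by simp
  add_mem' {a b} ha hb τ := by
    obtain ⟨R, Ω, h, -⟩ := τ.exists_rep
    have ha' := (TracialState.apply_star_mul_self_eq_zero_iff h a).1 (ha τ)
    have hb' := (TracialState.apply_star_mul_self_eq_zero_iff h b).1 (hb τ)
    rw [TracialState.apply_star_mul_self_eq_zero_iff h, map_add, add_apply, ha', hb', add_zero]
  smul_mem' a b hb τ := by
    obtain ⟨R, Ω, h, -⟩ := τ.exists_rep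
    have hb' := (TracialState.apply_star_mul_self_eq_zero_iff h b).1 (hb τ)
    rw [TracialState.apply_star_mul_self_eq_zero_iff h, smul_eq_mul, map_mul, mul_apply_eq_comp,
      hb', map_zero]

theorem mem_kacIdeal {b : B} : b ∈ kacIdeal B ↔ ∀ τ : TracialState B, τ (star b * b) = 0 :=
  Iff.rfl

theorem TracialState.apply_mul_eq_zero (τ : TracialState B) {b : B} (hb : b ∈ kacIdeal B) (a : B) :
    τ (a * b) = 0 := by
  obtain ⟨R, Ω, h, -⟩ := τ.exists_rep
  rw [← h, map_mul, mul_apply_eq_comp,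
    (TracialState.apply_star_mul_self_eq_zero_iff h b).1 (hb τ), map_zero, inner_zero_right]

instance : (kacIdeal B).IsTwoSided where
  mul_mem_of_left {b} a hb τ := by
    rw [star_mul, mul_assoc, τ.tracial, mul_assoc, mul_assoc, τ.tracial, mul_assoc, mul_assoc,
      τ.tracial]
    simp only [← mul_assoc]
    exact τ.apply_mul_eq_zero hb _

theorem star_mem_kacIdeal {b : B} (hb : b ∈ kacIdeal B) : star b ∈ kacIdeal B := fun τ => by
  rw [star_star, τ.tracial]; exact hb τ

theorem isClosed_kacIdeal : IsClosed (kacIdeal B : Set B) := by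
  have : (kacIdeal B : Set B) = ⋂ τ : TracialState B, {b | τ (star b * b) = 0} := by
    ext b; simp [mem_kacIdeal]
  rw [this]
  refine isClosed_iInter fun τ => ?_
  obtain ⟨R, Ω, h, -⟩ := τ.exists_rep
  simp_rw [TracialState.apply_star_mul_self_eq_zero_iff h]
  exact isClosed_eq (R.hom.continuous'.clm_apply continuous_const) continuous_const

variable (B) in
/-- The ideal as a non-unital `*`-subalgebra. -/
def kacSubalgebra : NonUnitalStarSubalgebra ℂ B where
  carrier := kacIdeal B
  zero_mem' := (kacIdeal B).zero_mem
  add_mem' := (kacIdeal B).add_mem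
  mul_mem' {a _} _ hb := (kacIdeal B).mul_mem_left a hb
  smul_mem' c _ hx := (kacIdeal B).smul_of_tower_mem c hx
  star_mem' := star_mem_kacIdeal

theorem exists_approximate_unit {j : B} (hj : j ∈ kacIdeal B) {ε : ℝ} (hε : 0 < ε) :
    ∃ e ∈ kacIdeal B, ‖1 - e‖ ≤ 1 ∧ ‖j - j * e‖ < ε := by
  have hcl : IsClosed (kacSubalgebra B : Set B) := isClosed_kacIdeal
  let _ : PartialOrder (kacSubalgebra B) := CStarAlgebra.spectralOrder _
  let _ : StarOrderedRing (kacSubalgebra B) := CStarAlgebra.spectralOrderedRing _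
  let _ : PartialOrder B := CStarAlgebra.spectralOrder B
  let _ : StarOrderedRing B := CStarAlgebra.spectralOrderedRing B
  have hl := CStarAlgebra.increasingApproximateUnit (kacSubalgebra B)
  have := hl.neBot
  let j' : kacSubalgebra B := ⟨j, (show j ∈ kacSubalgebra B from hj)⟩
  have h1 := (hl.tendsto_mul_left j').eventually
    (Metric.ball_mem_nhds _ hε)
  obtain ⟨e, he1, he2, he3⟩ := (h1.and (hl.eventually_nonneg.and hl.eventually_norm)).exists
  refine ⟨e, e.2, ?_, ?_⟩
  · have he0 : (0 : B) ≤ e := by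
      obtain ⟨s, rfl⟩ := CStarAlgebra.nonneg_iff_eq_star_mul_self.mp he2
      exact star_mul_self_nonneg (s : B)
    have hle : (e : B) ≤ 1 := (CStarAlgebra.norm_le_one_iff_of_nonneg (e : B) he0).1 he3
    rw [CStarAlgebra.norm_le_one_iff_of_nonneg (1 - e : B) (sub_nonneg.2 hle)]
    exact sub_le_self 1 he0
  · rw [dist_comm, dist_eq_norm] at he1
    exact he1

end KacIdeal

section KacQuotient

variable (B : Type u) [CStarAlgebra B]

/-- The quotient of a C*-algebra by the intersection of the left kernels of its tracial states. -/
def KacQuotient : Type u := B ⧸ kacIdeal B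

namespace KacQuotient

instance : NormedAddCommGroup (KacQuotient B) :=
  haveI : IsClosed (kacIdeal B : Set B) := isClosed_kacIdeal
  inferInstanceAs (NormedAddCommGroup (B ⧸ kacIdeal B))

instance : Ring (KacQuotient B) := inferInstanceAs (Ring (B ⧸ kacIdeal B))

instance : Algebra ℂ (KacQuotient B) := inferInstanceAs (Algebra ℂ (B ⧸ kacIdeal B))

instance : CompleteSpace (KacQuotient B) := inferInstanceAs (CompleteSpace (B ⧸ kacIdeal B))

/-- The quotient map, as a homomorphism of algebras. -/
def mkAlg : B →ₐ[ℂ] KacQuotient B := Ideal.Quotient.mkₐ ℂ (kacIdeal B)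

variable {B}

theorem mkAlg_surjective : Function.Surjective (mkAlg B) := Ideal.Quotient.mk_surjective

theorem mkAlg_eq_zero {b : B} : mkAlg B b = 0 ↔ b ∈ kacIdeal B := Ideal.Quotient.eq_zero_iff_mem

theorem mkAlg_eq {a b : B} : mkAlg B a = mkAlg B b ↔ a - b ∈ kacIdeal B := Ideal.Quotient.eq

theorem norm_mkAlg_le (b : B) : ‖mkAlg B b‖ ≤ ‖b‖ := Submodule.Quotient.norm_mk_le (kacIdeal B) b

theorem exists_norm_lt (x : KacQuotient B) {ε : ℝ} (hε : 0 < ε) :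
    ∃ b, mkAlg B b = x ∧ ‖b‖ < ‖x‖ + ε := Submodule.Quotient.norm_mk_lt x hε

instance : NormedRing (KacQuotient B) where
  __ := (inferInstance : NormedAddCommGroup (KacQuotient B))
  __ := (inferInstance : Ring (KacQuotient B))
  norm_mul_le x y := by
    have h : ∀ ε > 0, ‖x * y‖ ≤ (‖x‖ + ε) * (‖y‖ + ε) := by
      intro ε hε
      obtain ⟨a, rfl, ha⟩ := exists_norm_lt x hε
      obtain ⟨b, rfl, hb⟩ := exists_norm_lt y hε
      rw [← map_mul]
      exact (norm_mkAlg_le _).trans ((norm_mul_le a b).trans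
        (mul_le_mul ha.le hb.le (norm_nonneg _) (by positivity)))
    have hlim : Filter.Tendsto (fun ε : ℝ => (‖x‖ + ε) * (‖y‖ + ε)) (nhdsWithin 0 (Set.Ioi 0))
        (nhds ((‖x‖ + 0) * (‖y‖ + 0))) :=
      (Continuous.tendsto (by fun_prop) 0).mono_left nhdsWithin_le_nhds
    rw [add_zero, add_zero] at hlim
    exact ge_of_tendsto hlim (Filter.eventually_of_mem self_mem_nhdsWithin h)

instance : NormedAlgebra ℂ (KacQuotient B) where
  norm_smul_le c x := by
    refine le_of_forall_pos_le_add fun ε hε => ?_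
    have hd : 0 < ε / (‖c‖ + 1) := by positivity
    obtain ⟨b, rfl, hb⟩ := exists_norm_lt x hd
    rw [← map_smul]
    refine (norm_mkAlg_le _).trans ?_
    rw [norm_smul]
    refine (mul_le_mul_of_nonneg_left hb.le (norm_nonneg c)).trans ?_
    rw [mul_add]
    have : ‖c‖ * (ε / (‖c‖ + 1)) ≤ ε := by
      rw [mul_div_assoc', div_le_iff₀ (by positivity)]
      nlinarith [norm_nonneg c]
    linarith

instance : Star (KacQuotient B) where
  star := Quotient.map' (s₁ := (kacIdeal B).quotientRel) (s₂ := (kacIdeal B).quotientRel) star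
    (by
      intro a b h
      rw [Submodule.quotientRel_def] at h ⊢
      rw [← star_sub]
      exact star_mem_kacIdeal h)

theorem star_mkAlg (b : B) : star (mkAlg B b) = mkAlg B (star b) := rfl

instance : StarRing (KacQuotient B) where
  star_involutive x := by
    obtain ⟨a, rfl⟩ := mkAlg_surjective x
    rw [star_mkAlg, star_mkAlg, star_star]
  star_mul x y := by
    obtain ⟨a, rfl⟩ := mkAlg_surjective x
    obtain ⟨b, rfl⟩ := mkAlg_surjective y
    rw [star_mkAlg, star_mkAlg, ← map_mul, ← map_mul, star_mkAlg, star_mul]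
  star_add x y := by
    obtain ⟨a, rfl⟩ := mkAlg_surjective x
    obtain ⟨b, rfl⟩ := mkAlg_surjective y
    rw [star_mkAlg, star_mkAlg, ← map_add, ← map_add, star_mkAlg, star_add]

instance : StarModule ℂ (KacQuotient B) where
  star_smul c x := by
    obtain ⟨a, rfl⟩ := mkAlg_surjective x
    rw [star_mkAlg, ← map_smul, ← map_smul, star_mkAlg, star_smul]

instance : CStarRing (KacQuotient B) where
  norm_mul_self_le x := by
    obtain ⟨b, rfl⟩ := mkAlg_surjective x
    refine le_of_forall_pos_le_add fun ε hε => ?_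
    obtain ⟨r, hr, hrn⟩ := exists_norm_lt (star (mkAlg B b) * mkAlg B b) (half_pos hε)
    rw [star_mkAlg, ← map_mul] at hr
    obtain ⟨e, he, he1, hje⟩ := exists_approximate_unit (mkAlg_eq.1 hr.symm) (half_pos hε)
    have h1 : mkAlg B b = mkAlg B (b * (1 - e)) := by
      rw [mkAlg_eq, mul_sub, mul_one, sub_sub_cancel]
      exact (kacIdeal B).mul_mem_left b he
    have h2 : ‖star b * b * (1 - e)‖ ≤ ‖r‖ + ε / 2 := by
      have : star b * b * (1 - e) = r * (1 - e) +
          ((star b * b - r) - (star b * b - r) * e) := by noncomm_ring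
      rw [this]
      refine (norm_add_le _ _).trans (add_le_add ((norm_mul_le _ _).trans ?_) hje.le)
      exact mul_le_of_le_one_right (norm_nonneg _) he1
    calc ‖mkAlg B b‖ * ‖mkAlg B b‖ ≤ ‖b * (1 - e)‖ * ‖b * (1 - e)‖ := by
          rw [h1]
          exact mul_self_le_mul_self (norm_nonneg _) (norm_mkAlg_le _)
      _ = ‖star (1 - e) * (star b * b * (1 - e))‖ := by
          rw [← CStarRing.norm_star_mul_self, star_mul]; simp only [mul_assoc]
      _ ≤ ‖star (1 - e)‖ * ‖star b * b * (1 - e)‖ := norm_mul_le _ _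
      _ ≤ ‖star b * b * (1 - e)‖ := by
          rw [norm_star]; exact mul_le_of_le_one_left (norm_nonneg _) he1
      _ ≤ ‖r‖ + ε / 2 := h2
      _ ≤ _ := by linarith

instance : CStarAlgebra (KacQuotient B) where

variable (B) in
/-- The quotient map `π : B → B_Kac`. -/
def mk : B →⋆ₐ[ℂ] KacQuotient B where
  toAlgHom := mkAlg B
  map_star' _ := rfl

theorem mk_surjective : Function.Surjective (mk B) := mkAlg_surjective

theorem mk_eq_zero {b : B} : mk B b = 0 ↔ b ∈ kacIdeal B := mkAlg_eq_zero

/-- A `*`-homomorphism vanishing on the ideal factors through the quotient. -/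
def lift {D : Type*} [CStarAlgebra D] (f : B →⋆ₐ[ℂ] D) (hf : ∀ b ∈ kacIdeal B, f b = 0) :
    KacQuotient B →⋆ₐ[ℂ] D where
  toAlgHom := (Ideal.Quotient.liftₐ (kacIdeal B) f.toAlgHom hf : B ⧸ kacIdeal B →ₐ[ℂ] D)
  map_star' x := by
    obtain ⟨a, rfl⟩ := mkAlg_surjective x
    exact map_star f a

@[simp] theorem lift_mk {D : Type*} [CStarAlgebra D] (f : B →⋆ₐ[ℂ] D)
    (hf : ∀ b ∈ kacIdeal B, f b = 0) (b : B) : lift f hf (mk B b) = f b := rfl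

end KacQuotient

end KacQuotient

section QuantumGroups

/-- A compact quantum group: a unital C*-algebra with a coassociative comultiplication satisfying
the density (cancellation) conditions. -/
class CompactQuantumGroup (B : Type u) [CStarAlgebra B] where
  /-- The comultiplication. -/
  comul : B →⋆ₐ[ℂ] MinTensor B B
  coassoc : ∀ b, MinTensor.assoc B B B (MinTensor.map comul (StarAlgHom.id ℂ B) (comul b)) =
    MinTensor.map (StarAlgHom.id ℂ B) comul (comul b)
  dense_left : Dense (Submodule.span ℂ
    {x | ∃ a b : B, x = MinTensor.tmul a 1 * comul b} : Set (MinTensor B B))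
  dense_right : Dense (Submodule.span ℂ
    {x | ∃ a b : B, x = comul a * MinTensor.tmul 1 b} : Set (MinTensor B B))

open CompactQuantumGroup

/-- A morphism of compact quantum groups, at the level of the C*-algebras. -/
structure QuantumGroupHom (B C : Type u) [CStarAlgebra B] [CStarAlgebra C]
    [CompactQuantumGroup B] [CompactQuantumGroup C] where
  /-- The underlying homomorphism of C*-algebras. -/
  hom : B →⋆ₐ[ℂ] C
  comul_hom : ∀ b, comul (hom b) = MinTensor.map hom hom (comul b)

/-- A morphism of compact quantum groups is an isomorphism if it has an inverse morphism. -/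
def QuantumGroupHom.IsIso {B C : Type u} [CStarAlgebra B] [CStarAlgebra C]
    [CompactQuantumGroup B] [CompactQuantumGroup C] (f : QuantumGroupHom B C) : Prop :=
  ∃ g : QuantumGroupHom C B, (∀ b, g.hom (f.hom b) = b) ∧ ∀ c, f.hom (g.hom c) = c

end QuantumGroups

section KacComultiplication

open scoped ComplexOrder

theorem HilbertTensor.continuous_vec₂ {H K : Type u} [NormedAddCommGroup H]
    [InnerProductSpace ℂ H] [NormedAddCommGroup K] [InnerProductSpace ℂ K] :
    Continuous (fun p : H × K => vec p.1 p.2) :=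
  (incl H K).continuous.comp TensorProduct.continuous_tmul

variable {A B : Type u} [CStarAlgebra A] [CStarAlgebra B]

section ProductTrace

variable {R : HilbertRep A} {S : HilbertRep B} {Ω₁ : R.H} {Ω₂ : S.H}
  {τ₁ : TracialState A} {τ₂ : TracialState B}

/-- The product of two tracial vector states is tracial on the minimal tensor product. -/
theorem inner_rep_mul_comm (h₁ : ∀ a, inner ℂ Ω₁ (R.hom a Ω₁) = τ₁ a)
    (h₂ : ∀ b, inner ℂ Ω₂ (S.hom b Ω₂) = τ₂ b) (x y : MinTensor A B) :
    inner ℂ (HilbertTensor.vec Ω₁ Ω₂)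
        (MinTensor.rep R.hom S.hom (x * y) (HilbertTensor.vec Ω₁ Ω₂)) =
      inner ℂ (HilbertTensor.vec Ω₁ Ω₂)
        (MinTensor.rep R.hom S.hom (y * x) (HilbertTensor.vec Ω₁ Ω₂)) := by
  have hc : Continuous fun z : MinTensor A B => (inner ℂ (HilbertTensor.vec Ω₁ Ω₂)
      (MinTensor.rep R.hom S.hom z (HilbertTensor.vec Ω₁ Ω₂)) : ℂ) :=
    continuous_const.inner ((MinTensor.rep R.hom S.hom).continuous'.clm_apply continuous_const)
  refine MinTensor.tmul_induction (P := fun x => inner ℂ (HilbertTensor.vec Ω₁ Ω₂)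
        (MinTensor.rep R.hom S.hom (x * y) (HilbertTensor.vec Ω₁ Ω₂)) =
      inner ℂ (HilbertTensor.vec Ω₁ Ω₂)
        (MinTensor.rep R.hom S.hom (y * x) (HilbertTensor.vec Ω₁ Ω₂)))
    (isClosed_eq (hc.comp (continuous_id.mul continuous_const))
      (hc.comp (continuous_const.mul continuous_id))) (by simp) (fun a b => ?_)
    (fun x x' hx hx' => by
      simp only [add_mul, mul_add, map_add, add_apply, inner_add_right, hx, hx']) x
  refine MinTensor.tmul_induction (P := fun y => inner ℂ (HilbertTensor.vec Ω₁ Ω₂)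
        (MinTensor.rep R.hom S.hom (MinTensor.tmul a b * y) (HilbertTensor.vec Ω₁ Ω₂)) =
      inner ℂ (HilbertTensor.vec Ω₁ Ω₂)
        (MinTensor.rep R.hom S.hom (y * MinTensor.tmul a b) (HilbertTensor.vec Ω₁ Ω₂)))
    (isClosed_eq (hc.comp (continuous_const.mul continuous_id))
      (hc.comp (continuous_id.mul continuous_const))) (by simp) (fun a' b' => ?_)
    (fun x x' hx hx' => by
      simp only [add_mul, mul_add, map_add, add_apply, inner_add_right, hx, hx']) y
  rw [MinTensor.tmul_mul_tmul, MinTensor.tmul_mul_tmul, MinTensor.rep_tmul, MinTensor.rep_tmul,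
    HilbertTensor.op_vec, HilbertTensor.op_vec, HilbertTensor.inner_vec, HilbertTensor.inner_vec,
    h₁, h₁, h₂, h₂, τ₁.tracial, τ₂.tracial]

theorem inner_rep_star_mul (x y : MinTensor A B) (v : HilbertTensor R.H S.H) :
    inner ℂ v (MinTensor.rep R.hom S.hom (star x * y) v) =
      inner ℂ (MinTensor.rep R.hom S.hom x v) (MinTensor.rep R.hom S.hom y v) := by
  rw [map_mul, map_star, mul_apply_eq_comp, ContinuousLinearMap.star_eq_adjoint,
    ContinuousLinearMap.adjoint_inner_right]

theorem rep_mul_vec_eq_zero (h₁ : ∀ a, inner ℂ Ω₁ (R.hom a Ω₁) = τ₁ a)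
    (h₂ : ∀ b, inner ℂ Ω₂ (S.hom b Ω₂) = τ₂ b) {c : MinTensor A B}
    (hc : MinTensor.rep R.hom S.hom c (HilbertTensor.vec Ω₁ Ω₂) = 0) (y : MinTensor A B) :
    MinTensor.rep R.hom S.hom (c * y) (HilbertTensor.vec Ω₁ Ω₂) = 0 := by
  have e : inner ℂ (HilbertTensor.vec Ω₁ Ω₂) (MinTensor.rep R.hom S.hom
      (star (c * y) * (c * y)) (HilbertTensor.vec Ω₁ Ω₂)) =
      inner ℂ (HilbertTensor.vec Ω₁ Ω₂) (MinTensor.rep R.hom S.hom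
        ((y * star (c * y)) * c) (HilbertTensor.vec Ω₁ Ω₂)) := by
    rw [inner_rep_mul_comm h₁ h₂ (star (c * y)), mul_assoc c,
      inner_rep_mul_comm h₁ h₂ c]
  have e' : MinTensor.rep R.hom S.hom ((y * star (c * y)) * c) (HilbertTensor.vec Ω₁ Ω₂) = 0 := by
    have := congrArg (MinTensor.rep R.hom S.hom (y * star (c * y))) hc
    rw [ContinuousLinearMap.map_zero] at this
    rw [← this, _root_.map_mul]
    rfl
  rw [e', inner_zero_right, inner_rep_star_mul] at e
  exact inner_self_eq_zero.1 e

end ProductTrace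

theorem HilbertTensor.eq_zero_of_dense {H K D : Type u} [NormedAddCommGroup H]
    [InnerProductSpace ℂ H] [NormedAddCommGroup K] [InnerProductSpace ℂ K]
    [NormedAddCommGroup D] [NormedSpace ℂ D] {ι κ : Type*} {p : ι → H} {q : κ → K}
    (hp : DenseRange p) (hq : DenseRange q) (T : HilbertTensor H K →L[ℂ] D)
    (h : ∀ i j, T (vec (p i) (q j)) = 0) : T = 0 := by
  have hc : Continuous fun x : H × K => T (vec x.1 x.2) := T.continuous.comp continuous_vec₂
  have hall : ∀ x : H × K, T (vec x.1 x.2) = 0 := fun x =>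
    (hp.prodMap hq).induction_on x (isClosed_eq hc continuous_const) fun i => h i.1 i.2
  exact ext_op fun v w => hall (v, w)

/-- An element annihilated by the product of two tracial vector states lies in the kernel of the
tensor product of the corresponding representations. -/
theorem rep_eq_zero_of_tracial {R : HilbertRep A} {S : HilbertRep B} {Ω₁ : R.H} {Ω₂ : S.H}
    {τ₁ : TracialState A} {τ₂ : TracialState B} (h₁ : ∀ a, inner ℂ Ω₁ (R.hom a Ω₁) = τ₁ a)
    (h₂ : ∀ b, inner ℂ Ω₂ (S.hom b Ω₂) = τ₂ b) (hd₁ : DenseRange fun a => R.hom a Ω₁)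
    (hd₂ : DenseRange fun b => S.hom b Ω₂) {c : MinTensor A B}
    (hc : MinTensor.rep R.hom S.hom c (HilbertTensor.vec Ω₁ Ω₂) = 0) :
    MinTensor.rep R.hom S.hom c = 0 := by
  refine HilbertTensor.eq_zero_of_dense hd₁ hd₂ _ fun k l => ?_
  have h := rep_mul_vec_eq_zero h₁ h₂ hc (MinTensor.tmul k l)
  rwa [map_mul, mul_apply_eq_comp, MinTensor.rep_tmul, HilbertTensor.op_vec] at h


open CompactQuantumGroup

/-- The tracial state on the quotient induced by a tracial state. -/
theorem TracialState.exists_descend (τ' : TracialState A) :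
    ∃ τ : TracialState (KacQuotient A), ∀ a, τ (KacQuotient.mk A a) = τ' a := by
  have hw : ∀ a b, KacQuotient.mk A a = KacQuotient.mk A b → τ' a = τ' b := by
    intro a b h
    rw [← sub_eq_zero, ← map_sub, KacQuotient.mk_eq_zero] at h
    have := τ'.apply_mul_eq_zero h 1
    rwa [one_mul, map_sub, sub_eq_zero] at this
  let s := Function.surjInv (KacQuotient.mk_surjective (B := A))
  have hs : ∀ x, KacQuotient.mk A (s x) = x :=
    Function.surjInv_eq (KacQuotient.mk_surjective (B := A))
  have hτ : ∀ a, τ' (s (KacQuotient.mk A a)) = τ' a := fun a => hw _ _ (hs _)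
  refine ⟨⟨⟨⟨fun x => τ' (s x), fun x y => ?_⟩, fun c x => ?_⟩, fun x => ?_, ?_, fun x y => ?_⟩, hτ⟩
  · rw [← map_add]; exact hw _ _ (by rw [map_add, hs, hs, hs])
  · rw [← map_smul]; exact hw _ _ (by rw [hs, map_smul, RingHom.id_apply, hs])
  · change 0 ≤ τ' (s (star x * x))
    rw [hw (s (star x * x)) (star (s x) * s x) (by rw [hs, map_mul, map_star, hs])]
    exact τ'.nonneg _
  · change τ' (s 1) = 1
    rw [hw (s 1) 1 (by rw [hs, _root_.map_one]), τ'.map_one]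
  · change τ' (s (x * y)) = τ' (s (y * x))
    rw [hw (s (x * y)) (s x * s y) (by rw [hs, map_mul, hs, hs]),
      hw (s (y * x)) (s y * s x) (by rw [hs, map_mul, hs, hs]), τ'.tracial]

/-- Cyclic representations associated with tracial states. -/
def TracialState.reps (A : Type u) [CStarAlgebra A] : Set (HilbertRep A) :=
  {R | ∃ (τ : TracialState A) (Ω : R.H), (∀ a, inner ℂ Ω (R.hom a Ω) = τ a) ∧
    DenseRange fun a => R.hom a Ω}

theorem TracialState.reps_faithful {x : KacQuotient A}
    (h : ∀ R ∈ TracialState.reps (KacQuotient A), R.hom x = 0) : x = 0 := by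
  obtain ⟨b, rfl⟩ := KacQuotient.mk_surjective x
  rw [KacQuotient.mk_eq_zero]
  intro τ'
  obtain ⟨τ, hτ⟩ := τ'.exists_descend
  obtain ⟨R, Ω, hΩ, hd⟩ := τ.exists_rep
  rw [← hτ, map_mul, map_star, TracialState.apply_star_mul_self_eq_zero_iff hΩ,
    h R ⟨τ, Ω, hΩ, hd⟩, zero_apply]

/-- A unital `*`-homomorphism into the quotient tensor square kills the elements annihilated by all
tracial states. -/
theorem hom_eq_zero_of_mem_kacIdeal
    (f : A →⋆ₐ[ℂ] MinTensor (KacQuotient B) (KacQuotient B)) {a : A} (ha : a ∈ kacIdeal A) :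
    f a = 0 := by
  refine MinTensor.eq_zero_of_faithful (TracialState.reps _) (TracialState.reps _)
    (fun _ => TracialState.reps_faithful) (fun _ => TracialState.reps_faithful) ?_
  rintro R ⟨τ₁, Ω₁, h₁, hd₁⟩ S ⟨τ₂, Ω₂, h₂, hd₂⟩
  refine rep_eq_zero_of_tracial h₁ h₂ hd₁ hd₂ ?_
  let Ω := HilbertTensor.vec Ω₁ Ω₂
  let τ : TracialState A :=
    { toLinearMap :=
        { toFun := fun y => inner ℂ Ω (MinTensor.rep R.hom S.hom (f y) Ω)
          map_add' := fun x y => by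
            rw [map_add, map_add, add_apply, inner_add_right]
          map_smul' := fun c x => by
            rw [map_smul, map_smul, smul_apply, inner_smul_right]; rfl }
      nonneg := fun y => by
        change 0 ≤ inner ℂ Ω (MinTensor.rep R.hom S.hom (f (star y * y)) Ω)
        rw [map_mul, map_star, inner_rep_star_mul]
        rw [inner_self_eq_norm_sq_to_K]
        positivity
      map_one := by
        change inner ℂ Ω (MinTensor.rep R.hom S.hom (f 1) Ω) = 1
        have e₁ : inner ℂ Ω₁ Ω₁ = (1 : ℂ) := by
          have := h₁ 1
          rwa [_root_.map_one, τ₁.map_one] at this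
        have e₂ : inner ℂ Ω₂ Ω₂ = (1 : ℂ) := by
          have := h₂ 1
          rwa [_root_.map_one, τ₂.map_one] at this
        rw [_root_.map_one, _root_.map_one]
        exact (HilbertTensor.inner_vec _ _ _ _).trans (by rw [e₁, e₂, mul_one])
      tracial := fun x y => by
        change inner ℂ Ω (MinTensor.rep R.hom S.hom (f (x * y)) Ω) =
          inner ℂ Ω (MinTensor.rep R.hom S.hom (f (y * x)) Ω)
        rw [map_mul f, map_mul f, inner_rep_mul_comm h₁ h₂] }
  have h : inner ℂ Ω (MinTensor.rep R.hom S.hom (f (star a * a)) Ω) = 0 := ha τ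
  rwa [map_mul, map_star, inner_rep_star_mul, inner_self_eq_zero] at h

theorem KacQuotient.hom_ext {D : Type*} [CStarAlgebra D] {f g : KacQuotient A →⋆ₐ[ℂ] D}
    (h : ∀ a, f (KacQuotient.mk A a) = g (KacQuotient.mk A a)) : f = g := by
  ext x
  obtain ⟨a, rfl⟩ := KacQuotient.mk_surjective x
  exact h a

theorem MinTensor.denseRange_map_mk :
    DenseRange (MinTensor.map (KacQuotient.mk A) (KacQuotient.mk B)) := by
  intro x
  refine MinTensor.tmul_induction (P := fun x => x ∈ closure (Set.range
    (MinTensor.map (KacQuotient.mk A) (KacQuotient.mk B)))) isClosed_closure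
    (subset_closure ⟨0, map_zero _⟩) (fun a b => ?_) (fun x y hx hy => ?_) x
  · obtain ⟨a, rfl⟩ := KacQuotient.mk_surjective a
    obtain ⟨b, rfl⟩ := KacQuotient.mk_surjective b
    exact subset_closure ⟨MinTensor.tmul a b, MinTensor.map_tmul _ _ a b⟩
  · exact map_mem_closure₂ continuous_add hx hy (by
      rintro _ ⟨x, rfl⟩ _ ⟨y, rfl⟩
      exact ⟨x + y, map_add _ _ _⟩)

/-- The image of a dense span under a `*`-homomorphism with dense range. -/
theorem dense_span_of_map {D E : Type*} [CStarAlgebra D] [CStarAlgebra E] (f : D →⋆ₐ[ℂ] E)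
    (hf : DenseRange f) {s : Set D} {t : Set E} (hst : Set.MapsTo f s t)
    (hs : Dense (Submodule.span ℂ s : Set D)) : Dense (Submodule.span ℂ t : Set E) := by
  refine (hf.dense_image f.continuous' hs).mono ?_
  rintro _ ⟨x, hx, rfl⟩
  exact (Submodule.span_le.2 (fun y hy => Submodule.subset_span (hst hy)) :
    Submodule.span ℂ s ≤ (Submodule.span ℂ t).comap f.toAlgHom.toLinearMap) hx

theorem map_mem_kacIdeal (f : A →⋆ₐ[ℂ] B) {a : A} (ha : a ∈ kacIdeal A) : f a ∈ kacIdeal B :=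
  fun τ => by
    rw [← map_star, ← map_mul]
    exact ha ⟨τ.toLinearMap ∘ₗ f.toAlgHom.toLinearMap,
      fun x => by
        change 0 ≤ τ (f (star x * x))
        rw [map_mul, map_star]; exact τ.nonneg _,
      by
        change τ (f 1) = 1
        rw [map_one, τ.map_one],
      fun x y => by
        change τ (f (x * y)) = τ (f (y * x))
        rw [map_mul f, map_mul f, τ.tracial]⟩

/-- The homomorphism between the quotients induced by a homomorphism of C*-algebras. -/
def KacQuotient.map (f : A →⋆ₐ[ℂ] B) : KacQuotient A →⋆ₐ[ℂ] KacQuotient B :=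
  lift ((mk B).comp f) fun _ ha => mk_eq_zero.2 (map_mem_kacIdeal f ha)

theorem KacQuotient.map_mk (f : A →⋆ₐ[ℂ] B) (a : A) : map f (mk A a) = mk B (f a) :=
  lift_mk _ _ a

variable [CompactQuantumGroup A] [CompactQuantumGroup B]

namespace KacQuotient

variable (B) in
/-- The comultiplication of the canonical Kac quotient: `mk b ↦ (mk ⊗ mk) (comul b)`. -/
def kacComul : KacQuotient B →⋆ₐ[ℂ] MinTensor (KacQuotient B) (KacQuotient B) :=
  lift ((MinTensor.map (mk B) (mk B)).comp comul) fun _ hb => hom_eq_zero_of_mem_kacIdeal _ hb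

theorem kacComul_mk (b : B) : kacComul B (mk B b) = MinTensor.map (mk B) (mk B) (comul b) :=
  lift_mk _ _ b

variable (B) in
/-- The canonical Kac quotient of a compact quantum group. -/
instance : CompactQuantumGroup (KacQuotient B) where
  comul := kacComul B
  coassoc x := by
    obtain ⟨b, rfl⟩ := mk_surjective x
    have e : (kacComul B).comp (mk B) = (MinTensor.map (mk B) (mk B)).comp comul :=
      StarAlgHom.ext kacComul_mk
    rw [kacComul_mk, MinTensor.map_map, MinTensor.map_map, e]
    have e₁ : (StarAlgHom.id ℂ (KacQuotient B)).comp (mk B) =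
      (mk B).comp (StarAlgHom.id ℂ B) := rfl
    rw [e₁, ← MinTensor.map_map, ← MinTensor.map_map, MinTensor.assoc_map, coassoc]
  dense_left := by
    refine dense_span_of_map _ MinTensor.denseRange_map_mk ?_ dense_left
    rintro _ ⟨a, b, rfl⟩
    exact ⟨mk B a, mk B b, by rw [map_mul, MinTensor.map_tmul, map_one, kacComul_mk]⟩
  dense_right := by
    refine dense_span_of_map _ MinTensor.denseRange_map_mk ?_ dense_right
    rintro _ ⟨a, b, rfl⟩
    exact ⟨mk B a, mk B b, by rw [map_mul, MinTensor.map_tmul, map_one, kacComul_mk]⟩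

theorem comul_mk (b : B) : comul (mk B b) = MinTensor.map (mk B) (mk B) (comul b) :=
  kacComul_mk b

end KacQuotient

/-- The morphism between the canonical Kac quotients induced by a morphism of compact quantum
groups. -/
def QuantumGroupHom.kacMap (Θ : QuantumGroupHom A B) :
    QuantumGroupHom (KacQuotient A) (KacQuotient B) where
  hom := KacQuotient.map Θ.hom
  comul_hom x := by
    obtain ⟨a, rfl⟩ := KacQuotient.mk_surjective x
    have e : (KacQuotient.map Θ.hom).comp (KacQuotient.mk A) = (KacQuotient.mk B).comp Θ.hom :=
      StarAlgHom.ext (KacQuotient.map_mk Θ.hom)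
    rw [KacQuotient.map_mk, KacQuotient.comul_mk, KacQuotient.comul_mk, Θ.comul_hom,
      MinTensor.map_map, MinTensor.map_map, e]

theorem QuantumGroupHom.kacMap_mk (Θ : QuantumGroupHom A B) (a : A) :
    Θ.kacMap.hom (KacQuotient.mk A a) = KacQuotient.mk B (Θ.hom a) :=
  KacQuotient.map_mk Θ.hom a

end KacComultiplication

end

/-!
The hypothesis `ker Θ ≤ ker π₁` makes `π₁` factor as `k ∘ Θ`. Tracial states pull back along `k`,
and those of the Kac quotient of `B₁` separate its points, so `k` kills the Kac ideal of `B₂`.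
Hence `π₂ (Θ b) = 0` forces `π₁ b = k (Θ b) = 0`: the induced map is injective. It is surjective
because `Θ` and `π₂` are, and a bijective morphism of compact quantum groups is an isomorphism.
-/

theorem exists_starAlgHom_comp_eq_of_ker_le {R A B D : Type*} [CommSemiring R]
    [Ring A] [Algebra R A] [Star A] [Ring B] [Algebra R B] [Star B] [Ring D] [Algebra R D] [Star D]
    {f : A →⋆ₐ[R] B} (hf : Function.Surjective f) {g : A →⋆ₐ[R] D}
    (h : RingHom.ker f ≤ RingHom.ker g) : ∃ k : B →⋆ₐ[R] D, k.comp f = g := by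
  let k : B →+* D := (f : A →+* B).liftOfSurjective hf ⟨g, h⟩
  have hk (a : A) : k (f a) = g a := RingHom.liftOfSurjective_comp_apply _ hf _ a
  have hk_algebraMap (r : R) : k (algebraMap R B r) = algebraMap R D r := by
    simpa only [AlgHomClass.commutes] using hk (algebraMap R A r)
  have hk_star : ∀ b, k (star b) = star (k b) := hf.forall.2 fun a => by
    rw [hk a, ← map_star f, hk, map_star]
  exact ⟨{ k with commutes' := hk_algebraMap, map_star' := hk_star }, StarAlgHom.ext hk⟩

namespace MinTensor

variable {A B A' B' : Type u} [CStarAlgebra A] [CStarAlgebra B] [CStarAlgebra A'] [CStarAlgebra B']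

variable (A B) in
theorem map_id : map (StarAlgHom.id ℂ A) (StarAlgHom.id ℂ B) = StarAlgHom.id ℂ (MinTensor A B) :=
  hom_ext fun a b => map_tmul _ _ a b

theorem map_leftInverse {φ : A →⋆ₐ[ℂ] A'} {φ' : A' →⋆ₐ[ℂ] A} {ψ : B →⋆ₐ[ℂ] B'}
    {ψ' : B' →⋆ₐ[ℂ] B} (hφ : Function.LeftInverse φ' φ) (hψ : Function.LeftInverse ψ' ψ) :
    Function.LeftInverse (map φ' ψ') (map φ ψ) := fun x => by
  have hφ_comp : φ'.comp φ = StarAlgHom.id ℂ A := StarAlgHom.ext hφ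
  have hψ_comp : ψ'.comp ψ = StarAlgHom.id ℂ B := StarAlgHom.ext hψ
  rw [map_map, hφ_comp, hψ_comp, map_id, StarAlgHom.coe_id, id_eq]

end MinTensor

theorem QuantumGroupHom.isIso_of_bijective {A B : Type u} [CStarAlgebra A] [CStarAlgebra B]
    [CompactQuantumGroup A] [CompactQuantumGroup B] {f : QuantumGroupHom A B}
    (hf : Function.Bijective f.hom) : f.IsIso := by
  let e : A ≃⋆ₐ[ℂ] B := StarAlgEquiv.ofBijective f.hom hf
  let g : B →⋆ₐ[ℂ] A := e.symm
  have hgf : Function.LeftInverse g f.hom := e.symm_apply_apply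
  have hg_comul : ∀ b, CompactQuantumGroup.comul (g b) =
      MinTensor.map g g (CompactQuantumGroup.comul b) := hf.surjective.forall.2 fun a => by
    rw [hgf a, f.comul_hom, MinTensor.map_leftInverse hgf hgf]
  exact ⟨⟨g, hg_comul⟩, hgf, e.apply_symm_apply⟩

namespace KacQuotient

variable {A B : Type u} [CStarAlgebra A] [CStarAlgebra B]

variable (A) in
theorem kacIdeal_eq_bot : kacIdeal (KacQuotient A) = ⊥ := by
  refine (Submodule.eq_bot_iff _).2 (mk_surjective.forall.2 fun a ha => ?_)
  refine mk_eq_zero.2 fun τ => ?_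
  obtain ⟨τ', hτ'⟩ := τ.exists_descend
  rw [← hτ', map_mul, map_star]
  exact ha τ'

theorem kacIdeal_le_ker (k : B →⋆ₐ[ℂ] KacQuotient A) : kacIdeal B ≤ RingHom.ker k := fun b hb => by
  have hkb : k b ∈ kacIdeal (KacQuotient A) := map_mem_kacIdeal k hb
  rwa [kacIdeal_eq_bot] at hkb

theorem map_injective_of_ker_le {f : A →⋆ₐ[ℂ] B} (hf : Function.Surjective f)
    (h : RingHom.ker f ≤ RingHom.ker (mk A)) : Function.Injective (map f) := by
  obtain ⟨k, hk⟩ := exists_starAlgHom_comp_eq_of_ker_le hf h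
  refine (injective_iff_map_eq_zero _).2 (mk_surjective.forall.2 fun a ha => ?_)
  have hfa : f a ∈ kacIdeal B := mk_eq_zero.1 ((map_mk f a).symm.trans ha)
  calc mk A a = k (f a) := (DFunLike.congr_fun hk a).symm
    _ = 0 := kacIdeal_le_ker k hfa

theorem map_surjective {f : A →⋆ₐ[ℂ] B} (hf : Function.Surjective f) :
    Function.Surjective (map f) := by
  have h : Function.Surjective (map f ∘ mk A) := by
    simpa only [Function.comp_def, map_mk] using mk_surjective.comp hf
  exact h.of_comp

end KacQuotient

theorem lemma7p2 {B₁ B₂ : Type u} [CStarAlgebra B₁] [CStarAlgebra B₂]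
    [CompactQuantumGroup B₁] [CompactQuantumGroup B₂]
    (Θ : QuantumGroupHom B₁ B₂) (hΘ : Function.Surjective Θ.hom)
    (hker : RingHom.ker Θ.hom ≤ RingHom.ker (KacQuotient.mk B₁)) :
    (∀ b : B₁, Θ.kacMap.hom (KacQuotient.mk B₁ b) = KacQuotient.mk B₂ (Θ.hom b)) ∧
      Θ.kacMap.IsIso := by
  have hbij : Function.Bijective Θ.kacMap.hom :=
    ⟨KacQuotient.map_injective_of_ker_le hΘ hker, KacQuotient.map_surjective hΘ⟩
  exact ⟨Θ.kacMap_mk, QuantumGroupHom.isIso_of_bijective hbij⟩
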